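/- There is an absolute constant $C$ such that the following holds for every finite set $P$ of $n$ points in the Euclidean plane, no three of which are collinear. Definitions. For $\theta\in\mathbb R$ the open $\theta$-quadrant with apex $a$ is the open first quadrant, rotated by $\theta$ and translated to $a$. It is *$P$-free* if it contains no point of $P$, and a $P$-free $\theta$-quadrant is *extremal*, *supported by* $(u,v)$, if $u\neq v$ are points of $P$ such that $u$ lies on its closed bounding ray in the direction of the $y$-axis rotated by $\theta$ and $v$ lies on its closed bounding ray in the direction of the $x$-axis rotated by $\theta$. For an edge $e$ of the boundary of the convex hull of $P$ (if $n=2$ the segment counts as two edges, one for each of its sides), the *sub-chain* $A_e$ of the chain of arcs of $P$ consists of the apexes $a$ of the $P$-free extremal $\theta$-quadrants, $\theta\in[0,2\pi)$, that intersect $e$ and whose apex lies strictly on the inner side of the line through $e$, together with the two endpoints of $e$. A *link* of $A_e$ is the part of $A_e$ between two points of $P$ that are consecutive along $A_e$ (in the order of the orthogonal projections to $e$), these two points included. For an angle $\theta$, an *overlap* at $\theta$ is a pair of opposite extremal quadrants (orientations $\theta$ and $\theta+\pi$, or $\theta+\frac{\pi}{2}$ and $\theta+\frac{3\pi}{2}$)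 with nonempty intersection; it is identified by the pair of orientations and the four points of $P$ that support the two quadrants. An *overlap event* (*release event*) of the $\theta$-rectilinear convex hull $\mathcal{RH}_\theta(P)$ is an angle $\theta\in[0,2\pi)$ together with an overlap that appears (disappears) at $\theta$. Claim. 1. For any edges $e,f$ of the boundary of the convex hull of $P$, there are at most $C\,n$ points which lie on two different links from the sub-chains $A_e$ and $A_f$ (one link from each, or two links from the same sub-chain). 2. The number of overlap events plus the number of release events, as $\theta$ runs over $[0,2\pi)$, is at most $C\,n$. -/

import Mathlib

open Filter Topology

namespace RectHull

/-- The Euclidean plane. -/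
abbrev Pt : Type := EuclideanSpace ℝ (Fin 2)

/-- Unit vector of the `x`-axis rotated by `θ`. -/
noncomputable def xAxis (θ : ℝ) : Pt := !₂[Real.cos θ, Real.sin θ]

/-- Unit vector of the `y`-axis rotated by `θ`. -/
noncomputable def yAxis (θ : ℝ) : Pt := !₂[-Real.sin θ, Real.cos θ]

/-- `cross v w > 0` iff `w` points strictly to the left of `v`. -/
def cross (v w : Pt) : ℝ := v 0 * w 1 - v 1 * w 0

/-- No three distinct points of `P` are collinear. -/
def GeneralPosition (P : Finset Pt) : Prop :=
  ∀ a ∈ P, ∀ b ∈ P, ∀ c ∈ P, a ≠ b → a ≠ c → b ≠ c → ¬ Collinear ℝ ({a, b, c} : Set Pt)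

/-- The edges of the convex hull of `P` (a point set without three collinear points), directed
counterclockwise: all other points of `P` lie strictly to the left. Two points span the two
edges `(p, q)` and `(q, p)`. -/
def hullEdges (P : Finset Pt) : Set (Pt × Pt) :=
  {e | e.1 ∈ P ∧ e.2 ∈ P ∧ e.1 ≠ e.2 ∧
    ∀ r ∈ P, r ≠ e.1 → r ≠ e.2 → 0 < cross (e.2 - e.1) (r - e.1)}

/-- The open `θ`-quadrant with apex `a`: the first quadrant rotated by `θ` and translated to `a`.
The other three quadrants with respect to the rotated axes are obtained from
`θ + π / 2`, `θ + π` and `θ + 3 * π / 2`. -/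
def quadrant (θ : ℝ) (a : Pt) : Set Pt :=
  {x | 0 < inner ℝ (x - a) (xAxis θ) ∧ 0 < inner ℝ (x - a) (yAxis θ)}

/-- The open `θ`-quadrant with apex `a` is `P`-free and extremal, supported by the two distinct
points `u, v` of `P`: the bounding ray in the direction `yAxis θ` contains `u`, the one in the
direction `xAxis θ` contains `v`. Then `u` and `v` are consecutive, in this order along the
`x`-axis rotated by `θ`, among the points of `P` that are maximal for the `θ`-quadrant.
The bounding rays are closed, so that the apex itself may be one of the two points. -/
structure IsExtremal (P : Finset Pt) (θ : ℝ) (a u v : Pt) : Prop where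
  mem_left : u ∈ P
  mem_right : v ∈ P
  ne : u ≠ v
  left_x : inner ℝ (u - a) (xAxis θ) = 0
  left_y : 0 ≤ inner ℝ (u - a) (yAxis θ)
  right_x : 0 ≤ inner ℝ (v - a) (xAxis θ)
  right_y : inner ℝ (v - a) (yAxis θ) = 0
  free : ∀ r ∈ P, r ∉ quadrant θ a

/-- The sub-chain of the chain of arcs associated to the directed hull edge `e`: the apexes of the
`P`-free extremal quadrants, for `θ ∈ [0, 2π)`, which intersect `e` from the inner side,
that is, whose apex is on the side of the line through `e` where the hull lies. (A quadrant whose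
apex is outside the hull meets two hull edges, one where it enters the hull and one where it
leaves the hull; it belongs to the latter.) -/
def subChain (P : Finset Pt) (e : Pt × Pt) : Set Pt :=
  {a | ∃ θ ∈ Set.Ico (0 : ℝ) (2 * Real.pi), ∃ u v : Pt, IsExtremal P θ a u v ∧
    (quadrant θ a ∩ segment ℝ e.1 e.2).Nonempty ∧ 0 < cross (e.2 - e.1) (a - e.1)}

/-- The sub-chain together with its two end points, the end points of `e`. -/
def subChainCurve (P : Finset Pt) (e : Pt × Pt) : Set Pt :=
  subChain P e ∪ {e.1, e.2}

/-- The position, along the edge `e`, of the orthogonal projection of `a` (up to scale). -/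
noncomputable def pos (e : Pt × Pt) (a : Pt) : ℝ := inner ℝ (a - e.1) (e.2 - e.1)

/-- A link of the sub-chain of `e`: the part of the curve between two points of `P` that are
consecutive along it (the curve is monotone with respect to `e`). -/
def IsLink (P : Finset Pt) (e : Pt × Pt) (L : Set Pt) : Prop :=
  ∃ a ∈ P, ∃ b ∈ P, a ∈ subChainCurve P e ∧ b ∈ subChainCurve P e ∧ pos e a < pos e b ∧
    (∀ c ∈ P, c ∈ subChainCurve P e → ¬ (pos e a < pos e c ∧ pos e c < pos e b)) ∧
    L = {x | x ∈ subChainCurve P e ∧ pos e a ≤ pos e x ∧ pos e x ≤ pos e b}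

/-- The intersection points between two different links taken from the sub-chains of `e` and `f`,
be it one link from each sub-chain or two links from the same one. -/
def linkIntersections (P : Finset Pt) (e f : Pt × Pt) : Set Pt :=
  {x | ∃ e' ∈ ({e, f} : Set (Pt × Pt)), ∃ f' ∈ ({e, f} : Set (Pt × Pt)), ∃ L M : Set Pt,
    IsLink P e' L ∧ IsLink P f' M ∧ (e', L) ≠ (f', M) ∧ x ∈ L ∧ x ∈ M}

/-- The name of a rectangular overlap: which of the two pairs of opposite quadrants it comes from
(`0` for `θ, θ + π` and `1` for `θ + π / 2, θ + 3 * π / 2`), the points that support the first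
quadrant, and the points that support the opposite one. -/
structure OverlapKey where
  pair : Fin 2
  u : Pt
  v : Pt
  r : Pt
  s : Pt

/-- The set of rectangular overlaps at angle `θ`: the pairs of opposite extremal
quadrants with nonempty intersection. -/
def overlaps (P : Finset Pt) (θ : ℝ) : Set OverlapKey :=
  {k | ∃ a b : Pt,
    IsExtremal P (θ + (k.pair : ℕ) * (Real.pi / 2)) a k.u k.v ∧
    IsExtremal P (θ + (k.pair : ℕ) * (Real.pi / 2) + Real.pi) b k.r k.s ∧
    (quadrant (θ + (k.pair : ℕ) * (Real.pi / 2)) a ∩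
      quadrant (θ + (k.pair : ℕ) * (Real.pi / 2) + Real.pi) b).Nonempty}

/-- The overlap events: an angle `θ ∈ [0, 2π)` together with an overlap that appears at `θ`,
either present at `θ` but not just before, or absent at `θ` but present just after. -/
def overlapEvents (P : Finset Pt) : Set (ℝ × OverlapKey) :=
  {ev | ev.1 ∈ Set.Ico (0 : ℝ) (2 * Real.pi) ∧
    ((ev.2 ∈ overlaps P ev.1 ∧ ∃ᶠ t in 𝓝[<] ev.1, ev.2 ∉ overlaps P t) ∨
      (ev.2 ∉ overlaps P ev.1 ∧ ∃ᶠ t in 𝓝[>] ev.1, ev.2 ∈ overlaps P t))}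

/-- The release events: an angle `θ ∈ [0, 2π)` together with an overlap that disappears at `θ`,
either present at `θ` but not just after, or absent at `θ` but present just before. -/
def releaseEvents (P : Finset Pt) : Set (ℝ × OverlapKey) :=
  {ev | ev.1 ∈ Set.Ico (0 : ℝ) (2 * Real.pi) ∧
    ((ev.2 ∈ overlaps P ev.1 ∧ ∃ᶠ t in 𝓝[>] ev.1, ev.2 ∉ overlaps P t) ∨
      (ev.2 ∉ overlaps P ev.1 ∧ ∃ᶠ t in 𝓝[<] ev.1, ev.2 ∈ overlaps P t))}

end RectHull

/-!
Everything rests on partitions of `P` into two parts by two opposite, or at least disjoint, free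
right-angled sectors.

**Links.** In the coordinates of a free quadrant that leaves the hull through `e`, the edge descends
from the upper left to the lower right (`exists_faces`). So the quadrant contains the direction of
the outward normal of `e`, and as no apex off `P` lies in the quadrant of another apex of the same
sub-chain (`Faces.notMem_quadrant`), the sub-chain is monotone (`pos_injOn`). Hence two links of one
sub-chain meet only in points of `P`. A common apex `x ∉ P` of the sub-chains of two distinct edges
`e` and `f` is the apex of two disjoint free right-angled sectors; their complement consists of two
sectors `A` and `B`, and a point of `A` and a point of `B` are seen from `x` at an angle that is not
acute (`exists_rightAngleSplit`). The starting point of `e` is always in `A`, its end point always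
in `B`. A triangle has at most one angle that is not acute; therefore, for any two such apexes, the
parts of `P` in their sectors `A` are nested. Three apexes with the same parts are impossible: all
of them would lie in the two discs whose diameters join the supports of the middle one, whose
circles pass through the middle one, with one apex on either side of it. This gives at most
`2 * |P|` common apexes off `P` (`encard_le_of_splits`).

**Events.** Two opposite extremal quadrants overlap iff `P` splits into a part `L` to the upper left
and its complement to the lower right, and then the supports are the extreme points of the two parts
in the directions of the axes (`mem_overlaps_iff`). When the presence of an overlap changes, either
the overlap is present and two points tie for the role of a support, or it is absent and the two
parts are just in contact (`exists_event_of_change`).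
At a tie, one of the tied points lies on a bounding ray of a free quadrant at the other. At each
point only four such rays are possible for either orientation, because they lie in different
half-open quadrants (`encard_freeSectors_le`); and the tied points determine the angle and `L`.
For a contact, the vectors from the complement to `L` make acute angles with one another shortly
before or after. Two such acute splits do not cross (`AcuteSplit.noncrossing`), so that they form a
laminar family, of linear size (`encard_acuteSplit_le`), and each of them has a bounded number of
contacts. At a given angle, a split supports at most `16` overlaps, since a line contains at most
two points of `P`.
-/

open Filter Topology

namespace RectHull

/-! ### Rotated coordinates -/

/-- The first coordinate of `p` with respect to the axes rotated by `θ`. -/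
noncomputable def xc (θ : ℝ) (p : Pt) : ℝ := p 0 * Real.cos θ + p 1 * Real.sin θ

/-- The second coordinate of `p` with respect to the axes rotated by `θ`. -/
noncomputable def yc (θ : ℝ) (p : Pt) : ℝ := p 1 * Real.cos θ - p 0 * Real.sin θ

/-- The inner product of the plane, written out in coordinates. -/
def dot (v w : Pt) : ℝ := v 0 * w 0 + v 1 * w 1

theorem inner_eq_dot (v w : Pt) : inner ℝ v w = dot v w := by
  simp [PiLp.inner_apply, Fin.sum_univ_two, dot, mul_comm]

theorem inner_xAxis (θ : ℝ) (p : Pt) : inner ℝ p (xAxis θ) = xc θ p := by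
  simp [inner_eq_dot, dot, xAxis, xc]

theorem inner_yAxis (θ : ℝ) (p : Pt) : inner ℝ p (yAxis θ) = yc θ p := by
  simp [inner_eq_dot, dot, yAxis, yc]; ring

theorem xc_sub (θ : ℝ) (p q : Pt) : xc θ (p - q) = xc θ p - xc θ q := by
  simp [xc]; ring

theorem yc_sub (θ : ℝ) (p q : Pt) : yc θ (p - q) = yc θ p - yc θ q := by
  simp [yc]; ring

theorem xc_add_smul (θ s t : ℝ) (p q : Pt) : xc θ (s • p + t • q) = s * xc θ p + t * xc θ q := by
  simp [xc]; ring

theorem yc_add_smul (θ s t : ℝ) (p q : Pt) : yc θ (s • p + t • q) = s * yc θ p + t * yc θ q := by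
  simp [yc]; ring

theorem dot_eq (θ : ℝ) (v w : Pt) : dot v w = xc θ v * xc θ w + yc θ v * yc θ w := by
  simp only [dot, xc, yc]
  linear_combination (-(v 0 * w 0) - v 1 * w 1) * Real.sin_sq_add_cos_sq θ

theorem cross_eq (θ : ℝ) (v w : Pt) : cross v w = xc θ v * yc θ w - yc θ v * xc θ w := by
  simp only [cross, xc, yc]
  linear_combination (-(v 0 * w 1) + v 1 * w 0) * Real.sin_sq_add_cos_sq θ

theorem xc_change (θ φ : ℝ) (p : Pt) :
    xc φ p = Real.cos (φ - θ) * xc θ p + Real.sin (φ - θ) * yc θ p := by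
  simp only [xc, yc, Real.cos_sub, Real.sin_sub]
  linear_combination (-(p 0 * Real.cos φ) - p 1 * Real.sin φ) * Real.sin_sq_add_cos_sq θ

theorem yc_change (θ φ : ℝ) (p : Pt) :
    yc φ p = Real.cos (φ - θ) * yc θ p - Real.sin (φ - θ) * xc θ p := by
  simp only [xc, yc, Real.cos_sub, Real.sin_sub]
  linear_combination (-(p 1 * Real.cos φ) + p 0 * Real.sin φ) * Real.sin_sq_add_cos_sq θ

theorem ext_coord {p q : Pt} (θ : ℝ) (hx : xc θ p = xc θ q) (hy : yc θ p = yc θ q) : p = q := by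
  have h := Real.sin_sq_add_cos_sq θ
  simp only [xc, yc] at hx hy
  ext i
  fin_cases i
  · simp only [Fin.zero_eta]
    linear_combination Real.cos θ * hx - Real.sin θ * hy + (q 0 - p 0) * h
  · simp only [Fin.mk_one]
    linear_combination Real.sin θ * hx + Real.cos θ * hy + (q 1 - p 1) * h

theorem dot_self_pos {v : Pt} (h : v ≠ 0) : 0 < dot v v := by
  rw [← inner_eq_dot]
  exact real_inner_self_pos.2 h

theorem mem_quadrant {θ : ℝ} {a p : Pt} :
    p ∈ quadrant θ a ↔ 0 < xc θ (p - a) ∧ 0 < yc θ (p - a) := by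
  simp [quadrant, inner_xAxis, inner_yAxis]

theorem xc_add_pi (θ : ℝ) (p : Pt) : xc (θ + Real.pi) p = -xc θ p := by
  simp [xc]; ring

theorem yc_add_pi (θ : ℝ) (p : Pt) : yc (θ + Real.pi) p = -yc θ p := by
  simp [yc]; ring

/-! ### Counting along relations -/

/-- If every element of `S` is related to an element of `T`, and no element of `T` to more than
`k` elements of `S`, then `S` has at most `k * |T|` elements. -/
theorem encard_le_of_rel {α β : Type*} {S : Set α} {T : Set β} (R : α → β → Prop) {k m : ℕ}
    (hT : T.encard ≤ m) (hS : ∀ a ∈ S, ∃ b ∈ T, R a b)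
    (hR : ∀ b ∈ T, {a | a ∈ S ∧ R a b}.encard ≤ k) : S.encard ≤ (k * m : ℕ) := by
  have hfin : T.Finite := Set.finite_of_encard_le_coe hT
  have key : ∀ U : Finset β, (↑U ⊆ T) →
      {a | a ∈ S ∧ ∃ b ∈ U, R a b}.encard ≤ (k * U.card : ℕ) := by
    classical
    intro U
    induction U using Finset.induction_on with
    | empty => simp
    | insert b U hb ih =>
      intro hU
      have h1 := ih fun c hc => hU (by simp at hc; simp [hc])
      have h2 := hR b (hU (by simp))
      rw [Finset.card_insert_of_notMem hb, mul_add, mul_one, Nat.cast_add]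
      refine le_trans (Set.encard_le_encard ?_) ((Set.encard_union_le _ _).trans (add_le_add h1 h2))
      rintro a ⟨ha, c, hc, hac⟩
      rcases Finset.mem_insert.1 hc with rfl | hc
      · exact Or.inr ⟨ha, hac⟩
      · exact Or.inl ⟨ha, c, hc, hac⟩
  have h := key hfin.toFinset (by simp)
  have hm : hfin.toFinset.card ≤ m := by
    rw [hfin.encard_eq_coe_toFinset_card] at hT
    exact_mod_cast hT
  have hsub : S ⊆ {a | a ∈ S ∧ ∃ b ∈ hfin.toFinset, R a b} := fun a ha =>
    ⟨ha, by simpa using hS a ha⟩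
  exact (Set.encard_le_encard hsub).trans (h.trans (by exact_mod_cast Nat.mul_le_mul_left k hm))

theorem three_of_two_lt_encard {α : Type*} {S : Set α} (h : ¬ S.encard ≤ (2 : ℕ)) :
    ∃ a ∈ S, ∃ b ∈ S, ∃ c ∈ S, a ≠ b ∧ a ≠ c ∧ b ≠ c := by
  obtain ⟨T, hTS, hT⟩ := Set.exists_subset_encard_eq (s := S) (k := 3) (by
    have := Order.add_one_le_of_lt (not_le.1 h)
    norm_num at this ⊢
    exact this)
  obtain ⟨a, b, c, h1, h2, h3, rfl⟩ := Set.encard_eq_three.1 hT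
  exact ⟨a, hTS (by simp), b, hTS (by simp), c, hTS (by simp), h1, h2, h3⟩

/-! ### Quadrants leaving the hull through an edge -/

/-- The `P`-free quadrant with apex `x`, supported by `u` and `v`, leaves the hull through `e`:
in the coordinates of the quadrant, the edge starts at or below the bounding ray through `v` and
ends at or to the left of the one through `u`, and `x` is to its left. -/
structure Faces (P : Finset Pt) (e : Pt × Pt) (x : Pt) (θ : ℝ) (u v : Pt) : Prop where
  ext : IsExtremal P θ x u v
  start_x : 0 < xc θ (e.1 - x)
  start_y : yc θ (e.1 - x) ≤ 0
  end_x : xc θ (e.2 - x) ≤ 0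
  end_y : 0 < yc θ (e.2 - x)
  left : 0 < cross (e.1 - x) (e.2 - x)

theorem not_quadrant {P : Finset Pt} {θ : ℝ} {a u v r : Pt} (h : IsExtremal P θ a u v)
    (hr : r ∈ P) (hx : 0 < xc θ (r - a)) : yc θ (r - a) ≤ 0 := by
  by_contra hy
  exact h.free r hr (mem_quadrant.2 ⟨hx, not_le.1 hy⟩)

theorem cross_apex (p q x : Pt) : cross (q - p) (x - p) = cross (p - x) (q - x) := by
  simp [cross]; ring

theorem exists_faces {P : Finset Pt} {e : Pt × Pt} {x : Pt} (he : e ∈ hullEdges P)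
    (hx : x ∈ subChain P e) : ∃ θ u v, Faces P e x θ u v := by
  obtain ⟨θ, -, u, v, hext, ⟨z, hzQ, a, b, ha, hb, hab, rfl⟩, hleft⟩ := hx
  rw [cross_apex] at hleft
  obtain ⟨hzx, hzy⟩ := mem_quadrant.1 hzQ
  have hz : a • e.1 + b • e.2 - x = a • (e.1 - x) + b • (e.2 - x) := by
    have : x = (a + b) • x := by rw [hab, one_smul]
    nth_rewrite 1 [this]
    module
  rw [hz, xc_add_smul] at hzx
  rw [hz, yc_add_smul] at hzy
  have f1 := not_quadrant hext he.1
  have f2 := not_quadrant hext he.2.1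
  have hc := hleft
  rw [cross_eq θ] at hc
  suffices h : 0 < xc θ (e.1 - x) ∧ yc θ (e.1 - x) ≤ 0 ∧ xc θ (e.2 - x) ≤ 0 ∧
      0 < yc θ (e.2 - x) from
    ⟨θ, u, v, hext, h.1, h.2.1, h.2.2.1, h.2.2.2, hleft⟩
  generalize xc θ (e.1 - x) = x1 at *
  generalize yc θ (e.1 - x) = y1 at *
  generalize xc θ (e.2 - x) = x2 at *
  generalize yc θ (e.2 - x) = y2 at *
  have hy1 : y1 ≤ 0 := by
    by_contra! h
    have hx1 : x1 ≤ 0 := by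
      by_contra! h'
      exact absurd (f1 h') (not_le.2 h)
    have h1 : x1 * (a * y1 + b * y2) ≤ 0 := mul_nonpos_of_nonpos_of_nonneg hx1 hzy.le
    have h2 : 0 < y1 * (a * x1 + b * x2) := mul_pos h hzx
    nlinarith [mul_nonneg hb hc.le]
  have hy2 : 0 < y2 := by
    by_contra! h
    nlinarith [mul_nonpos_of_nonneg_of_nonpos ha hy1, mul_nonpos_of_nonneg_of_nonpos hb h]
  have hx2 : x2 ≤ 0 := by
    by_contra! h
    exact absurd (f2 h) (not_le.2 hy2)
  have hx1 : 0 < x1 := by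
    by_contra! h
    nlinarith [mul_nonpos_of_nonneg_of_nonpos ha h, mul_nonpos_of_nonneg_of_nonpos hb hx2]
  exact ⟨hx1, hy1, hx2, hy2⟩

section Supports
variable {P : Finset Pt} {θ : ℝ} {a u v : Pt}

theorem IsExtremal.xc_left (h : IsExtremal P θ a u v) : xc θ (u - a) = 0 := by
  rw [← inner_xAxis]; exact h.left_x

theorem IsExtremal.yc_right (h : IsExtremal P θ a u v) : yc θ (v - a) = 0 := by
  rw [← inner_yAxis]; exact h.right_y

theorem IsExtremal.yc_left_pos (h : IsExtremal P θ a u v) (ha : a ∉ P) : 0 < yc θ (u - a) := by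
  have h0 := h.left_y
  rw [inner_yAxis] at h0
  refine lt_of_le_of_ne h0 fun h1 => ha ?_
  have : u = a := ext_coord θ (by linarith [h.xc_left, xc_sub θ u a])
    (by linarith [yc_sub θ u a])
  exact this ▸ h.mem_left

theorem IsExtremal.xc_right_pos (h : IsExtremal P θ a u v) (ha : a ∉ P) : 0 < xc θ (v - a) := by
  have h0 := h.right_x
  rw [inner_xAxis] at h0
  refine lt_of_le_of_ne h0 fun h1 => ha ?_
  have : v = a := ext_coord θ (by linarith [xc_sub θ v a])
    (by linarith [h.yc_right, yc_sub θ v a])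
  exact this ▸ h.mem_right

end Supports

/-- An apex off `P` does not lie in the quadrant of another apex of the same sub-chain: it would see
more than a right angle free of points towards `e`. -/
theorem Faces.notMem_quadrant {P : Finset Pt} {e : Pt × Pt} {x y u v u' v' : Pt} {θ φ : ℝ}
    (hx : Faces P e x θ u v) (hy : Faces P e y φ u' v') (hyP : y ∉ P) : y ∉ quadrant θ x := by
  intro hyx
  obtain ⟨hα, hβ⟩ := mem_quadrant.1 hyx
  have shiftx : ∀ p, xc θ (p - x) = xc θ (p - y) + xc θ (y - x) := fun p => by
    simp only [xc_sub]; ring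
  have shifty : ∀ p, yc θ (p - x) = yc θ (p - y) + yc θ (y - x) := fun p => by
    simp only [yc_sub]; ring
  -- The closed quadrant at `y` with the axes of the quadrant at `x` contains no point of `P`.
  have hfree : ∀ p ∈ P, 0 ≤ xc θ (p - y) → yc θ (p - y) < 0 := fun p hp h => by
    have := not_quadrant hx.ext hp (by rw [shiftx]; linarith)
    rw [shifty] at this
    linarith
  have hu' := hfree u' hy.ext.mem_left
  have hv' := hfree v' hy.ext.mem_right
  have e1 := hx.start_y
  have e2 := hx.end_x
  have e3 := hy.start_y
  have e4 := hy.end_x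
  have hc := hy.left
  have hux := hy.ext.xc_left
  have huy := hy.ext.yc_left_pos hyP
  have hvx := hy.ext.xc_right_pos hyP
  have hvy := hy.ext.yc_right
  rw [shifty] at e1
  rw [shiftx] at e2
  rw [cross_eq θ] at hc
  rw [xc_change θ] at e4 hux hvx
  rw [yc_change θ] at e3 huy hvy
  have hcs := Real.sin_sq_add_cos_sq (φ - θ)
  have ux : xc θ (u' - y) = -Real.sin (φ - θ) *
      (Real.cos (φ - θ) * yc θ (u' - y) - Real.sin (φ - θ) * xc θ (u' - y)) := by
    linear_combination Real.cos (φ - θ) * hux - xc θ (u' - y) * hcs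
  have uy : yc θ (u' - y) = Real.cos (φ - θ) *
      (Real.cos (φ - θ) * yc θ (u' - y) - Real.sin (φ - θ) * xc θ (u' - y)) := by
    linear_combination Real.sin (φ - θ) * hux - yc θ (u' - y) * hcs
  have vx : xc θ (v' - y) = Real.cos (φ - θ) *
      (Real.cos (φ - θ) * xc θ (v' - y) + Real.sin (φ - θ) * yc θ (v' - y)) := by
    linear_combination -Real.sin (φ - θ) * hvy - xc θ (v' - y) * hcs
  have vy : yc θ (v' - y) = Real.sin (φ - θ) *
      (Real.cos (φ - θ) * xc θ (v' - y) + Real.sin (φ - θ) * yc θ (v' - y)) := by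
    linear_combination Real.cos (φ - θ) * hvy - yc θ (v' - y) * hcs
  have hcneg : Real.cos (φ - θ) < 0 := by
    by_contra! hc0
    have hs : 0 < Real.sin (φ - θ) := by
      by_contra! hs
      have := hu' (by rw [ux]; exact mul_nonneg (by linarith) huy.le)
      rw [uy] at this
      exact absurd (mul_nonneg hc0 huy.le) (not_le.2 this)
    have := hv' (by rw [vx]; exact mul_nonneg hc0 hvx.le)
    rw [vy] at this
    exact absurd (mul_nonneg hs.le hvx.le) (not_le.2 this)
  generalize Real.cos (φ - θ) = c at *
  generalize Real.sin (φ - θ) = s at *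
  generalize xc θ (e.1 - y) = a1 at *
  generalize yc θ (e.1 - y) = b1 at *
  generalize xc θ (e.2 - y) = a2 at *
  generalize yc θ (e.2 - y) = b2 at *
  have hb1 : b1 < 0 := by linarith
  have ha2 : a2 < 0 := by linarith
  have h1 : 0 < s * a1 := by nlinarith
  have h2 : s * b2 < 0 := by nlinarith
  have h3 : 0 < a2 * b1 := mul_pos_of_neg_of_neg ha2 hb1
  rcases lt_trichotomy s 0 with hs | rfl | hs
  · have : a1 < 0 := by by_contra! h; nlinarith
    have : 0 < b2 := by by_contra! h; nlinarith
    nlinarith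
  · simp at h1
  · have : 0 < a1 := by by_contra! h; nlinarith
    have : b2 < 0 := by by_contra! h; nlinarith
    nlinarith

/-- The outward normal of the edge points into the quadrant. -/
theorem Faces.mem_quadrant_of_outward {P : Finset Pt} {e : Pt × Pt} {x y u v : Pt} {θ : ℝ}
    (hx : Faces P e x θ u v) (hdot : dot (y - x) (e.2 - e.1) = 0)
    (hcross : cross (e.2 - e.1) (y - x) < 0) : y ∈ quadrant θ x := by
  have hdx : xc θ (e.2 - e.1) = xc θ (e.2 - x) - xc θ (e.1 - x) := by simp only [xc_sub]; ring
  have hdy : yc θ (e.2 - e.1) = yc θ (e.2 - x) - yc θ (e.1 - x) := by simp only [yc_sub]; ring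
  have h1 : xc θ (e.2 - e.1) < 0 := by linarith [hx.start_x, hx.end_x]
  have h2 : 0 < yc θ (e.2 - e.1) := by linarith [hx.start_y, hx.end_y]
  rw [dot_eq θ] at hdot
  rw [cross_eq θ] at hcross
  rw [mem_quadrant]
  generalize xc θ (e.2 - e.1) = d1 at *
  generalize yc θ (e.2 - e.1) = d2 at *
  generalize xc θ (y - x) = a at *
  generalize yc θ (y - x) = b at *
  have ha : 0 < a := by
    by_contra! h
    have hb : 0 < b := by
      by_contra! hb
      nlinarith [mul_nonneg_of_nonpos_of_nonpos h1.le hb, mul_nonpos_of_nonneg_of_nonpos h2.le h]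
    nlinarith [mul_nonneg_of_nonpos_of_nonpos h h1.le, mul_pos hb h2]
  refine ⟨ha, ?_⟩
  by_contra! hb
  nlinarith [mul_neg_of_pos_of_neg ha h1, mul_nonpos_of_nonpos_of_nonneg hb h2.le]

theorem eq_of_dot_cross {v w : Pt} (hv : v ≠ 0) (h1 : dot w v = 0) (h2 : cross v w = 0) :
    w = 0 := by
  by_contra hw
  have := mul_pos (dot_self_pos hv) (dot_self_pos hw)
  simp only [dot, cross] at *
  nlinarith [sq_nonneg (w 0 * v 0 + w 1 * v 1), sq_nonneg (v 0 * w 1 - v 1 * w 0)]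

theorem pos_sub (e : Pt × Pt) (x y : Pt) : pos e y - pos e x = dot (y - x) (e.2 - e.1) := by
  simp only [pos, inner_eq_dot, dot, PiLp.sub_apply]; ring

/-- The sub-chain of an edge is monotone: its points are determined by their projections. -/
theorem pos_injOn {P : Finset Pt} {e : Pt × Pt} (he : e ∈ hullEdges P) :
    Set.InjOn (pos e) (subChainCurve P e) := by
  have hne : e.2 - e.1 ≠ 0 := sub_ne_zero.2 (Ne.symm he.2.2.1)
  have base : ∀ x ∈ subChain P e, ∀ y ∈ subChainCurve P e, pos e x = pos e y →
      ¬ cross (e.2 - e.1) (y - x) < 0 := by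
    intro x hx y hy hxy hc
    obtain ⟨θ, u, v, hF⟩ := exists_faces he hx
    have hq := hF.mem_quadrant_of_outward (by rw [← pos_sub, hxy, sub_self]) hc
    have hyP : y ∉ P := fun hyP => hF.ext.free y hyP hq
    rcases hy with hy | rfl | rfl
    · obtain ⟨φ, u', v', hG⟩ := exists_faces he hy
      exact hF.notMem_quadrant hG hyP hq
    · exact hyP he.1
    · exact hyP he.2.1
  have base' : ∀ x ∈ subChain P e, ∀ y ∈ subChainCurve P e, pos e x = pos e y → x = y := by
    intro x hx y hy hxy
    have h1 := base x hx y hy hxy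
    have h2 : ¬ 0 < cross (e.2 - e.1) (y - x) := by
      intro h
      have hneg : cross (e.2 - e.1) (x - y) < 0 := by
        have : cross (e.2 - e.1) (x - y) = -cross (e.2 - e.1) (y - x) := by
          simp [cross]; ring
        linarith
      rcases hy with hy | hy
      · exact base y hy x (Or.inl hx) hxy.symm hneg
      · obtain ⟨-, -, -, -, -, -, hl⟩ := hx
        have : cross (e.2 - e.1) (x - y) = cross (e.2 - e.1) (x - e.1) := by
          rcases hy with rfl | rfl
          · rfl
          · simp [cross]; ring
        linarith
    have h3 := eq_of_dot_cross hne (w := y - x) (by rw [← pos_sub, hxy, sub_self])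
      (le_antisymm (not_lt.1 h2) (not_lt.1 h1))
    exact (sub_eq_zero.1 h3).symm
  intro x hx y hy hxy
  rcases hx with hx | hx
  · exact base' x hx y hy hxy
  · rcases hy with hy | hy
    · exact (base' y hy x (Or.inr hx) hxy.symm).symm
    · have h0 : pos e e.2 - pos e e.1 ≠ 0 := by
        rw [pos_sub]; exact (dot_self_pos hne).ne'
      rcases hx with rfl | rfl <;> rcases hy with rfl | rfl
      · rfl
      · exact absurd (by rw [hxy, sub_self]) h0
      · exact absurd (by rw [hxy, sub_self]) h0
      · rfl

/-- Links of one sub-chain meet only in points of `P`; links of two sub-chains meet in points of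
`P` or in common apexes. -/
theorem linkIntersections_subset {P : Finset Pt} {e f : Pt × Pt} (he : e ∈ hullEdges P)
    (hf : f ∈ hullEdges P) :
    linkIntersections P e f ⊆ ↑P ∪ {x | e ≠ f ∧ x ∈ subChain P e ∧ x ∈ subChain P f ∧ x ∉ P} := by
  rintro x ⟨e', he', f', hf', L, M, ⟨a, haP, b, hbP, ha, hb, -, hab, rfl⟩,
    ⟨a', haP', b', hbP', ha', hb', -, hab', rfl⟩, hne, ⟨hxe, hxa, hxb⟩, ⟨hxf, hxa', hxb'⟩⟩
  by_cases hxP : x ∈ P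
  · exact Or.inl hxP
  right
  have strip : ∀ g ∈ hullEdges P, x ∈ subChainCurve P g → x ∈ subChain P g := by
    rintro g hg (h | rfl | rfl)
    · exact h
    · exact absurd hg.1 hxP
    · exact absurd hg.2.1 hxP
  have hE' : e' ∈ hullEdges P := by rcases he' with rfl | rfl <;> assumption
  have hF' : f' ∈ hullEdges P := by rcases hf' with rfl | rfl <;> assumption
  have se := strip e' hE' hxe
  have sf := strip f' hF' hxf
  by_cases hef : e' = f'
  · subst hef
    exfalso
    have hne' : ∀ c ∈ P, c ∈ subChainCurve P e' → pos e' c ≠ pos e' x := fun c hc hcc h =>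
      hxP (pos_injOn hE' hcc hxe h ▸ hc)
    have l1 := lt_of_le_of_ne hxa (hne' a haP ha)
    have l2 := lt_of_le_of_ne hxb (hne' b hbP hb).symm
    have l1' := lt_of_le_of_ne hxa' (hne' a' haP' ha')
    have l2' := lt_of_le_of_ne hxb' (hne' b' hbP' hb').symm
    have hA : pos e' a = pos e' a' := le_antisymm
      (not_lt.1 fun h => hab' a haP ha ⟨h, l1.trans l2'⟩)
      (not_lt.1 fun h => hab a' haP' ha' ⟨h, l1'.trans l2⟩)
    have hB : pos e' b = pos e' b' := le_antisymm
      (not_lt.1 fun h => hab b' hbP' hb' ⟨l1.trans l2', h⟩)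
      (not_lt.1 fun h => hab' b hbP hb ⟨l1'.trans l2, h⟩)
    exact hne (by rw [hA, hB])
  · rcases he' with rfl | rfl <;> rcases hf' with rfl | rfl
    · exact absurd rfl hef
    · exact ⟨hef, se, sf, hxP⟩
    · exact ⟨Ne.symm hef, sf, se, hxP⟩
    · exact absurd rfl hef

/-! ### Common apexes of two sub-chains -/

/-- A quadrant leaves the hull through only one edge. -/
theorem Faces.edge_unique {P : Finset Pt} {e f : Pt × Pt} {x u v u' v' : Pt} {θ φ : ℝ}
    (he : e ∈ hullEdges P) (hf : f ∈ hullEdges P) (hE : Faces P e x θ u v)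
    (hF : Faces P f x φ u' v') (hx : ∀ p, xc φ p = xc θ p) (hy : ∀ p, yc φ p = yc θ p) :
    e = f := by
  obtain ⟨-, e1x, e1y, e2x, e2y, ec⟩ := hE
  obtain ⟨-, f1x, f1y, f2x, f2y, fc⟩ := hF
  rw [hx] at f1x f2x
  rw [hy] at f1y f2y
  have left : ∀ g ∈ hullEdges P, ∀ r ∈ P,
      0 ≤ cross (g.2 - g.1) (r - g.1) := by
    intro g hg r hr
    by_cases h1 : r = g.1
    · simp [h1, cross]
    by_cases h2 : r = g.2
    · simp [h2, cross, mul_comm]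
    exact (hg.2.2.2 r hr h1 h2).le
  have form : ∀ p q r : Pt, cross (q - p) (r - p) = cross (p - x) (q - x) -
      ((yc θ (q - x) - yc θ (p - x)) * xc θ (r - x) +
        (xc θ (p - x) - xc θ (q - x)) * yc θ (r - x)) := by
    intro p q r
    simp only [cross_eq θ, xc_sub, yc_sub]
    ring
  have a1 := left e he f.1 hf.1
  have a2 := left e he f.2 hf.2.1
  have b1 := left f hf e.1 he.1
  have b2 := left f hf e.2 he.2.1
  have s1 : cross (e.2 - e.1) (f.1 - e.1) = 0 → f.1 = e.1 := by
    intro h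
    by_contra h1
    by_cases h2 : f.1 = e.2
    · rw [h2] at f1y; linarith
    · exact absurd h (he.2.2.2 f.1 hf.1 h1 h2).ne'
  have s2 : cross (e.2 - e.1) (f.2 - e.1) = 0 → f.2 = e.2 := by
    intro h
    by_contra h1
    by_cases h2 : f.2 = e.1
    · rw [h2] at f2y; linarith
    · exact absurd h (he.2.2.2 f.2 hf.2.1 h2 h1).ne'
  suffices h : cross (e.2 - e.1) (f.1 - e.1) = 0 ∧ cross (e.2 - e.1) (f.2 - e.1) = 0 from
    Prod.ext (s1 h.1).symm (s2 h.2).symm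
  rw [form] at a1 a2 b1 b2
  rw [form e.1 e.2 f.1, form e.1 e.2 f.2]
  rw [cross_eq θ] at ec fc a1 a2 b1 b2 ⊢
  generalize xc θ (e.1 - x) = x1 at *
  generalize yc θ (e.1 - x) = y1 at *
  generalize xc θ (e.2 - x) = x2 at *
  generalize yc θ (e.2 - x) = y2 at *
  generalize xc θ (f.1 - x) = z1 at *
  generalize yc θ (f.1 - x) = w1 at *
  generalize xc θ (f.2 - x) = z2 at *
  generalize yc θ (f.2 - x) = w2 at *
  -- The difference of the two edges' normalized linear forms is nonnegative on the cone over `e`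
  -- and nonpositive on the cone over `f`; both cones contain the quadrant.
  obtain ⟨K, hK⟩ : ∃ K, K = x1 * y2 - y1 * x2 := ⟨_, rfl⟩
  obtain ⟨H, hH⟩ : ∃ H, H = z1 * w2 - w1 * z2 := ⟨_, rfl⟩
  obtain ⟨d, hd⟩ : ∃ d, d = H * (y2 - y1) - K * (w2 - w1) := ⟨_, rfl⟩
  obtain ⟨g, hg⟩ : ∃ g, g = H * (x1 - x2) - K * (z1 - z2) := ⟨_, rfl⟩
  rw [← hK] at ec a1 a2 ⊢
  rw [← hH] at fc b1 b2
  have p1 : 0 ≤ d * x1 + g * y1 := by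
    have : d * x1 + g * y1 = K * (H - ((w2 - w1) * x1 + (z1 - z2) * y1)) := by
      rw [hd, hg]; linear_combination -H * hK
    rw [this]; exact mul_nonneg ec.le b1
  have p2 : 0 ≤ d * x2 + g * y2 := by
    have : d * x2 + g * y2 = K * (H - ((w2 - w1) * x2 + (z1 - z2) * y2)) := by
      rw [hd, hg]; linear_combination -H * hK
    rw [this]; exact mul_nonneg ec.le b2
  have q1 : d * z1 + g * w1 = -(H * (K - ((y2 - y1) * z1 + (x1 - x2) * w1))) := by
    rw [hd, hg]; linear_combination K * hH
  have q2 : d * z2 + g * w2 = -(H * (K - ((y2 - y1) * z2 + (x1 - x2) * w2))) := by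
    rw [hd, hg]; linear_combination K * hH
  have q1' := mul_nonneg fc.le a1
  have q2' := mul_nonneg fc.le a2
  have d1 : 0 ≤ d * K := by
    have : d * K = y2 * (d * x1 + g * y1) + -y1 * (d * x2 + g * y2) := by rw [hK]; ring
    rw [this]
    exact add_nonneg (mul_nonneg e2y.le p1) (mul_nonneg (by linarith) p2)
  have g1 : 0 ≤ g * K := by
    have : g * K = -x2 * (d * x1 + g * y1) + x1 * (d * x2 + g * y2) := by rw [hK]; ring
    rw [this]
    exact add_nonneg (mul_nonneg (by linarith) p1) (mul_nonneg e1x.le p2)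
  have d2 : d * H ≤ 0 := by
    have : d * H = w2 * (d * z1 + g * w1) + -w1 * (d * z2 + g * w2) := by rw [hH]; ring
    rw [this]
    have := mul_nonneg f2y.le q1'
    have := mul_nonneg (show 0 ≤ -w1 by linarith) q2'
    rw [q1, q2]
    linarith
  have g2 : g * H ≤ 0 := by
    have : g * H = -z2 * (d * z1 + g * w1) + z1 * (d * z2 + g * w2) := by rw [hH]; ring
    rw [this]
    have := mul_nonneg (show 0 ≤ -z2 by linarith) q1'
    have := mul_nonneg f1x.le q2'
    rw [q1, q2]
    linarith
  have d0 : d = 0 := le_antisymm (nonpos_of_mul_nonpos_left d2 fc) (nonneg_of_mul_nonneg_left d1 ec)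
  have g0 : g = 0 := le_antisymm (nonpos_of_mul_nonpos_left g2 fc) (nonneg_of_mul_nonneg_left g1 ec)
  rw [d0, g0, zero_mul, zero_mul, add_zero, zero_eq_neg] at q1 q2
  exact ⟨(mul_eq_zero.1 q1).resolve_left fc.ne', (mul_eq_zero.1 q2).resolve_left fc.ne'⟩

/-- A partition of the plane around a common apex `x` of two sub-chains, up to the two free
right-angled sectors, into two sectors `A` and `B`; `X` stands for the set of all common
apexes. The field `tight` says that the two discs whose diameters join the supports of either right
angle do not contain both a point of `A` and a point of `B` besides `x` in their intersection: the
points `w` with `dot (v - w) (u - w) ≤ 0` are those of the disc with diameter `u v`. -/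
structure RightAngleSplit (P : Finset Pt) (X : Set Pt) (e : Pt × Pt) (x : Pt) (A B : Set Pt) :
    Prop where
  cover : ∀ p ∈ P, p ∈ A ∨ p ∈ B
  cover_apex : ∀ y ∈ X, y ≠ x → y ∈ A ∨ y ∈ B
  obtuse : ∀ p ∈ A, ∀ q ∈ B, dot (p - x) (q - x) ≤ 0
  start_mem : e.1 ∈ A
  end_mem : e.2 ∈ B
  tight : ∃ u ∈ P, ∃ v ∈ P, ∃ u' ∈ P, ∃ v' ∈ P, u ∈ B ∧ v ∈ A ∧ u' ∈ A ∧ v' ∈ B ∧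
    ∀ w ∈ A, ∀ z ∈ B, w ≠ x → z ≠ x →
      dot (v - w) (u - w) ≤ 0 → dot (u' - w) (v' - w) ≤ 0 →
      dot (v - z) (u - z) ≤ 0 → dot (u' - z) (v' - z) ≤ 0 → False

/-- For `n = (α, β)` and `n' = α' (c, s) + β' (-s, c)`, a vector `w = (a, b)` of the sector `A` that
makes acute angles with `n` and `n'` lies on the way from `n'` to `n`. -/
theorem cross_neg_of_mem_left {a b c s α β α' β' : ℝ} (hα : 0 < α) (hβ : 0 < β) (hα' : 0 < α')
    (hβ' : 0 < β') (h1 : b ≤ 0) (h2 : c * a + s * b ≤ 0) (h3 : 0 < a * α + b * β)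
    (h4 : 0 < (c * a + s * b) * α' + (c * b - s * a) * β') :
    α * (s * α' + c * β') - β * (c * α' - s * β') < 0 := by
  have ha : 0 < a := by
    by_contra! h
    nlinarith [mul_nonpos_of_nonpos_of_nonneg h hα.le, mul_nonpos_of_nonpos_of_nonneg h1 hβ.le]
  have hb' : 0 < c * b - s * a := by
    by_contra! h
    nlinarith [mul_nonpos_of_nonpos_of_nonneg h hβ'.le, mul_nonpos_of_nonpos_of_nonneg h2 hα'.le]
  have k1 : 0 < a * β - b * α := by
    nlinarith [mul_pos ha hβ, mul_nonpos_of_nonpos_of_nonneg h1 hα.le]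
  have k2 : 0 < (c * b - s * a) * α' - (c * a + s * b) * β' := by
    nlinarith [mul_pos hb' hα', mul_nonpos_of_nonpos_of_nonneg h2 hβ'.le]
  have id : (a * α + b * β) * ((c * b - s * a) * α' - (c * a + s * b) * β') +
      ((c * a + s * b) * α' + (c * b - s * a) * β') * (a * β - b * α) +
      (a ^ 2 + b ^ 2) * (α * (s * α' + c * β') - β * (c * α' - s * β')) = 0 := by ring
  have := mul_pos h3 k2
  have := mul_pos h4 k1
  by_contra! h
  have := mul_nonneg (add_nonneg (sq_nonneg a) (sq_nonneg b)) h
  linarith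

theorem cross_pos_of_mem_right {a b c s α β α' β' : ℝ} (hα : 0 < α) (hβ : 0 < β) (hα' : 0 < α')
    (hβ' : 0 < β') (h1 : a ≤ 0) (h2 : c * b - s * a ≤ 0) (h3 : 0 < a * α + b * β)
    (h4 : 0 < (c * a + s * b) * α' + (c * b - s * a) * β') :
    0 < α * (s * α' + c * β') - β * (c * α' - s * β') := by
  have hb : 0 < b := by
    by_contra! h
    nlinarith [mul_nonpos_of_nonpos_of_nonneg h1 hα.le, mul_nonpos_of_nonpos_of_nonneg h hβ.le]
  have ha' : 0 < c * a + s * b := by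
    by_contra! h
    nlinarith [mul_nonpos_of_nonpos_of_nonneg h hα'.le, mul_nonpos_of_nonpos_of_nonneg h2 hβ'.le]
  have k1 : 0 < b * α - a * β := by
    nlinarith [mul_pos hb hα, mul_nonpos_of_nonpos_of_nonneg h1 hβ.le]
  have k2 : 0 < (c * a + s * b) * β' - (c * b - s * a) * α' := by
    nlinarith [mul_pos ha' hβ', mul_nonpos_of_nonpos_of_nonneg h2 hα'.le]
  have id : (a * α + b * β) * ((c * a + s * b) * β' - (c * b - s * a) * α') +
      ((c * a + s * b) * α' + (c * b - s * a) * β') * (b * α - a * β) =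
      (a ^ 2 + b ^ 2) * (α * (s * α' + c * β') - β * (c * α' - s * β')) := by ring
  have := mul_pos h3 k2
  have := mul_pos h4 k1
  by_contra! h
  have := mul_nonpos_of_nonneg_of_nonpos (add_nonneg (sq_nonneg a) (sq_nonneg b)) h
  linarith

/-- The sector `A`, in the coordinates `(a, b)` of the first quadrant; `(c, s)` is the first axis of
the second quadrant. If the second quadrant is adjacent to the first one (`c = 0`), the first two
conditions describe a line or a half-plane; the last one cuts the line down to a ray. -/
def LeftSector (c s a b : ℝ) : Prop := b ≤ 0 ∧ c * a + s * b ≤ 0 ∧ (c = 0 → s < 0 → 0 ≤ a)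

/-- The sector `B`, see `LeftSector`. -/
def RightSector (c s a b : ℝ) : Prop := a ≤ 0 ∧ c * b - s * a ≤ 0 ∧ (c = 0 → 0 < s → 0 ≤ b)

theorem leftSector_or_rightSector {c s a b : ℝ} (hc : c ≤ 0) (hcs : s ^ 2 + c ^ 2 = 1)
    (h1 : 0 < a → b ≤ 0) (h2 : 0 < c * a + s * b → c * b - s * a ≤ 0) :
    LeftSector c s a b ∨ RightSector c s a b := by
  simp only [LeftSector, RightSector]
  rcases eq_or_lt_of_le hc with rfl | hc
  · have hs : (s - 1) * (s + 1) = 0 := by linarith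
    rcases mul_eq_zero.1 hs with h | h
    · obtain rfl : s = 1 := by linarith
      by_cases hb : b ≤ 0
      · left; simp [hb]
      · right
        have : a ≤ 0 := by by_contra! h; exact hb (h1 h)
        refine ⟨this, h2 (by simpa using hb), fun _ _ => by linarith⟩
    · obtain rfl : s = -1 := by linarith
      by_cases ha : a ≤ 0
      · right; simp [ha]
      · left
        have hb : b ≤ 0 := h1 (not_le.1 ha)
        refine ⟨hb, ?_, fun _ _ => by linarith⟩
        by_contra! h
        have := h2 h
        linarith
  · by_cases hb : b ≤ 0
    · by_cases ha' : c * a + s * b ≤ 0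
      · exact Or.inl ⟨hb, ha', fun h => absurd h hc.ne⟩
      have hb' := h2 (not_le.1 ha')
      refine Or.inr ⟨?_, hb', fun h => absurd h hc.ne⟩
      by_contra! ha
      have hs : s < 0 := by
        by_contra! hs
        nlinarith [mul_nonpos_of_nonneg_of_nonpos hs hb, mul_neg_of_neg_of_pos hc ha]
      nlinarith [mul_nonneg_of_nonpos_of_nonpos hc.le hb, mul_neg_of_neg_of_pos hs ha]
    · have hb := not_le.1 hb
      have ha : a ≤ 0 := by by_contra! h; linarith [h1 h]
      refine Or.inr ⟨ha, ?_, fun h => absurd h hc.ne⟩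
      by_contra! hb'
      have hs : 0 < s := by
        by_contra! hs
        nlinarith [mul_nonneg_of_nonpos_of_nonpos hs ha, mul_neg_of_neg_of_pos hc hb]
      have := h2 (by nlinarith [mul_nonneg_of_nonpos_of_nonpos hc.le ha, mul_pos hs hb])
      linarith

theorem obtuse_of_sectors {c s a b g h : ℝ} (hc : c ≤ 0) (hcs : s ^ 2 + c ^ 2 = 1)
    (hp : LeftSector c s a b) (hq : RightSector c s g h) : a * g + b * h ≤ 0 := by
  obtain ⟨p1, p2, p3⟩ := hp
  obtain ⟨q1, q2, q3⟩ := hq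
  rcases eq_or_lt_of_le hc with rfl | hc
  · have hs : (s - 1) * (s + 1) = 0 := by linarith
    rcases mul_eq_zero.1 hs with h | h
    · obtain rfl : s = 1 := by linarith
      obtain rfl : g = 0 := by linarith
      have := mul_nonpos_of_nonpos_of_nonneg p1 (q3 rfl one_pos)
      linarith
    · obtain rfl : s = -1 := by linarith
      obtain rfl : b = 0 := by linarith
      have := mul_nonpos_of_nonneg_of_nonpos (p3 rfl (by norm_num)) q1
      linarith
  · have h1 := mul_nonneg_of_nonpos_of_nonpos p2 q1
    have h2 := mul_nonneg_of_nonpos_of_nonpos p1 q2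
    by_contra! h3
    nlinarith [mul_neg_of_neg_of_pos hc h3]

theorem exists_rightAngleSplit {P : Finset Pt} {e f : Pt × Pt} {x : Pt} (he : e ∈ hullEdges P)
    (hf : f ∈ hullEdges P) (hef : e ≠ f) (hxe : x ∈ subChain P e) (hxf : x ∈ subChain P f)
    (hxP : x ∉ P) :
    ∃ A B, RightAngleSplit P {x | e ≠ f ∧ x ∈ subChain P e ∧ x ∈ subChain P f ∧ x ∉ P} e x A B := by
  obtain ⟨θ, u, v, hE⟩ := exists_faces he hxe
  obtain ⟨φ, u', v', hF⟩ := exists_faces hf hxf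
  have fE : ∀ p ∈ P, 0 < xc θ (p - x) → yc θ (p - x) ≤ 0 := fun p hp => not_quadrant hE.ext hp
  have fF : ∀ p ∈ P, 0 < xc φ (p - x) → yc φ (p - x) ≤ 0 := fun p hp => not_quadrant hF.ext hp
  have ux := hE.ext.xc_left
  have uy := hE.ext.yc_left_pos hxP
  have vx := hE.ext.xc_right_pos hxP
  have vy := hE.ext.yc_right
  have ux' := hF.ext.xc_left
  have uy' := hF.ext.yc_left_pos hxP
  have vx' := hF.ext.xc_right_pos hxP
  have vy' := hF.ext.yc_right
  have cx := xc_change θ φ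
  have cy := yc_change θ φ
  have hcs := Real.sin_sq_add_cos_sq (φ - θ)
  -- The second quadrant does not meet the first one, since no support is in the other quadrant.
  have hc : Real.cos (φ - θ) ≤ 0 := by
    by_contra! hc
    have hs : Real.sin (φ - θ) = 0 := by
      rcases lt_trichotomy (Real.sin (φ - θ)) 0 with h | h | h
      · have := fF v hE.ext.mem_right (by rw [cx, vy]; nlinarith [mul_pos hc vx])
        rw [cy, vy] at this
        nlinarith [mul_neg_of_neg_of_pos h vx]
      · exact h
      · have := fF u hE.ext.mem_left (by rw [cx, ux]; nlinarith [mul_pos h uy])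
        rw [cy, ux] at this
        nlinarith [mul_pos hc uy]
    have hc1 : Real.cos (φ - θ) = 1 := by
      rw [hs] at hcs
      nlinarith
    rw [hs, hc1] at cx cy
    exact hef (hE.edge_unique he hf hF (fun p => by rw [cx]; ring) fun p => by rw [cy]; ring)
  obtain ⟨c, hcd⟩ : ∃ c, c = Real.cos (φ - θ) := ⟨_, rfl⟩
  obtain ⟨s, hsd⟩ : ∃ s, s = Real.sin (φ - θ) := ⟨_, rfl⟩
  rw [← hcd] at cx cy hcs hc
  rw [← hsd] at cx cy hcs
  have hcov : ∀ p, (0 < xc θ (p - x) → yc θ (p - x) ≤ 0) → (0 < xc φ (p - x) → yc φ (p - x) ≤ 0) →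
      LeftSector c s (xc θ (p - x)) (yc θ (p - x)) ∨
        RightSector c s (xc θ (p - x)) (yc θ (p - x)) := fun p h1 h2 =>
    leftSector_or_rightSector hc hcs h1 (by rw [cx, cy] at h2; exact h2)
  have hcovP := fun p hp => hcov p (fE p hp) (fF p hp)
  have hobt : ∀ p q, LeftSector c s (xc θ (p - x)) (yc θ (p - x)) →
      RightSector c s (xc θ (q - x)) (yc θ (q - x)) → dot (p - x) (q - x) ≤ 0 := fun p q hp hq => by
    rw [dot_eq θ]
    exact obtuse_of_sectors hc hcs hp hq
  have hu : RightSector c s (xc θ (u - x)) (yc θ (u - x)) :=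
    (hcovP u hE.ext.mem_left).resolve_left fun h => absurd h.1 (not_le.2 uy)
  have hv : LeftSector c s (xc θ (v - x)) (yc θ (v - x)) :=
    (hcovP v hE.ext.mem_right).resolve_right fun h => absurd h.1 (not_le.2 vx)
  have hu' : LeftSector c s (xc θ (u' - x)) (yc θ (u' - x)) :=
    (hcovP u' hF.ext.mem_left).resolve_right fun h => absurd h.2.1 (by rw [← cy]; exact not_le.2 uy')
  have hv' : RightSector c s (xc θ (v' - x)) (yc θ (v' - x)) :=
    (hcovP v' hF.ext.mem_right).resolve_left fun h =>
      absurd h.2.1 (by rw [← cx]; exact not_le.2 vx')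
  refine ⟨{p | LeftSector c s (xc θ (p - x)) (yc θ (p - x))},
    {p | RightSector c s (xc θ (p - x)) (yc θ (p - x))}, hcovP, ?_, fun p hp q hq => hobt p q hp hq,
    (hcovP e.1 he.1).resolve_right fun h => absurd h.1 (not_le.2 hE.start_x),
    (hcovP e.2 he.2.1).resolve_left fun h => absurd h.1 (not_le.2 hE.end_y),
    u, hE.ext.mem_left, v, hE.ext.mem_right, u', hF.ext.mem_left, v', hF.ext.mem_right,
    hu, hv, hu', hv', ?_⟩
  · rintro y ⟨-, hye, hyf, hyP⟩ -
    obtain ⟨_, _, _, hG⟩ := exists_faces he hye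
    obtain ⟨_, _, _, hH⟩ := exists_faces hf hyf
    refine hcov y (fun h => ?_) fun h => ?_
    · by_contra! h'
      exact hE.notMem_quadrant hG hyP (mem_quadrant.2 ⟨h, h'⟩)
    · by_contra! h'
      exact hF.notMem_quadrant hH hyP (mem_quadrant.2 ⟨h, h'⟩)
  · intro w hw z hz hwx hzx w1 w2 z1 z2
    -- A point of the disc over a right angle at `x` makes an acute angle with the inner normal.
    have disc : ∀ (t p q : Pt), t ≠ x → ∀ ψ, xc ψ (q - x) = 0 → yc ψ (p - x) = 0 →
        dot (p - t) (q - t) ≤ 0 →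
        0 < xc ψ (t - x) * xc ψ (p - x) + yc ψ (t - x) * yc ψ (q - x) := by
      intro t p q ht ψ h1 h2 h3
      have h4 := dot_self_pos (sub_ne_zero.2 ht)
      rw [dot_eq ψ] at h3 h4
      simp only [xc_sub, yc_sub] at h1 h2 h3 h4 ⊢
      rw [sub_eq_zero.1 h1, sub_eq_zero.1 h2] at h3
      linarith
    have dw := disc w v u hwx θ ux vy w1
    have dz := disc z v u hzx θ ux vy z1
    have dw' := disc w v' u' hwx φ ux' vy' (by simpa [dot, mul_comm] using w2)
    have dz' := disc z v' u' hzx φ ux' vy' (by simpa [dot, mul_comm] using z2)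
    rw [cx (w - x), cy (w - x)] at dw'
    rw [cx (z - x), cy (z - x)] at dz'
    have k1 := cross_neg_of_mem_left vx uy vx' uy' hw.1 hw.2.1 dw dw'
    have k2 := cross_pos_of_mem_right vx uy vx' uy' hz.1 hz.2.1 dz dz'
    linarith

/-- In a triangle at most one angle is not acute. -/
theorem eq_of_two_obtuse {x y p : Pt} (h1 : dot (p - x) (y - x) ≤ 0)
    (h2 : dot (p - y) (x - y) ≤ 0) : x = y := by
  by_contra h
  have := dot_self_pos (sub_ne_zero.2 h)
  simp only [dot, PiLp.sub_apply] at *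
  nlinarith

theorem dot_comm (v w : Pt) : dot v w = dot w v := by simp [dot, mul_comm]

/-- The splits at the common apexes form a chain, in which every split occurs at most twice. -/
theorem encard_le_of_splits {P : Finset Pt} {X : Set Pt} {e : Pt × Pt} (hXP : ∀ x ∈ X, x ∉ P)
    (he : e.2 ∈ P) (h : ∀ x ∈ X, ∃ A B, RightAngleSplit P X e x A B) :
    X.encard ≤ (2 * P.card : ℕ) := by
  classical
  choose! A B hAB using h
  have hdisj : ∀ x ∈ X, ∀ p ∈ P, p ∈ A x → p ∈ B x → False := by
    intro x hx p hp h1 h2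
    have := (hAB x hx).obtuse p h1 p h2
    exact absurd (dot_self_pos (sub_ne_zero.2 fun h : p = x => hXP x hx (h ▸ hp))) (not_lt.2 this)
  have hAobt : ∀ x ∈ X, ∀ p ∈ B x, ∀ q ∈ A x, dot (p - x) (q - x) ≤ 0 := fun x hx p hp q hq => by
    rw [dot_comm]; exact (hAB x hx).obtuse q hq p hp
  have order : ∀ x ∈ X, ∀ y ∈ X, x ≠ y → (y ∈ B x ∧ x ∈ A y ∧ ∀ p ∈ P, p ∈ A x → p ∈ A y) ∨
      (y ∈ A x ∧ x ∈ B y ∧ ∀ p ∈ P, p ∈ A y → p ∈ A x) := by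
    intro x hx y hy hxy
    rcases (hAB x hx).cover_apex y hy hxy.symm with h1 | h1
    · right
      rcases (hAB y hy).cover_apex x hx hxy with h2 | h2
      · exact absurd (eq_of_two_obtuse (hAobt x hx _ (hAB x hx).end_mem y h1)
          (hAobt y hy _ (hAB y hy).end_mem x h2)) hxy
      refine ⟨h1, h2, fun p hp hpy => ((hAB x hx).cover p hp).resolve_right fun hpx => ?_⟩
      exact hxy (eq_of_two_obtuse (hAobt x hx p hpx y h1) ((hAB y hy).obtuse p hpy x h2))
    · left
      rcases (hAB y hy).cover_apex x hx hxy with h2 | h2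
      · refine ⟨h1, h2, fun p hp hpx => ((hAB y hy).cover p hp).resolve_right fun hpy => ?_⟩
        exact hxy (eq_of_two_obtuse ((hAB x hx).obtuse p hpx y h1) (hAobt y hy p hpy x h2))
      · exact absurd (eq_of_two_obtuse ((hAB x hx).obtuse _ (hAB x hx).start_mem y h1)
          ((hAB y hy).obtuse _ (hAB y hy).start_mem x h2)) hxy
  have middle : ∀ x ∈ X, ∀ y ∈ X, ∀ z ∈ X, x ≠ y → z ≠ y → (∀ p ∈ P, p ∈ A y ↔ p ∈ A x) →
      (∀ p ∈ P, p ∈ A y ↔ p ∈ A z) → x ∈ A y → z ∈ B y → False := by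
    intro x hx y hy z hz hxy hzy hx' hz' hxA hzB
    obtain ⟨u, hu, v, hv, u', hu', v', hv', uB, vA, uA', vB', ht⟩ := (hAB y hy).tight
    have flip : ∀ t ∈ X, (∀ p ∈ P, p ∈ A y ↔ p ∈ A t) → ∀ p ∈ P, p ∈ B y → p ∈ B t :=
      fun t ht htt p hp hpB => ((hAB t ht).cover p hp).resolve_left fun h =>
        hdisj y hy p hp ((htt p hp).2 h) hpB
    exact ht x hxA z hzB hxy hzy
      ((hAB x hx).obtuse v ((hx' v hv).1 vA) u (flip x hx hx' u hu uB))
      ((hAB x hx).obtuse u' ((hx' u' hu').1 uA') v' (flip x hx hx' v' hv' vB'))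
      ((hAB z hz).obtuse v ((hz' v hv).1 vA) u (flip z hz hz' u hu uB))
      ((hAB z hz).obtuse u' ((hz' u' hu').1 uA') v' (flip z hz hz' v' hv' vB'))
  refine encard_le_of_rel (T := (↑(Finset.range P.card) : Set ℕ))
    (fun x n => (P.filter (· ∈ A x)).card = n) (by rw [Set.encard_coe_eq_coe_finsetCard, Finset.card_range])
    (fun x hx => ⟨_, ?_, rfl⟩) ?_
  · simp only [Finset.coe_range, Set.mem_Iio]
    refine Finset.card_lt_card (Finset.filter_ssubset.2 ⟨e.2, he, fun h => ?_⟩)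
    exact hdisj x hx _ he h (hAB x hx).end_mem
  · intro n _
    by_contra hcon
    obtain ⟨x, ⟨hx, hxn⟩, y, ⟨hy, hyn⟩, z, ⟨hz, hzn⟩, hxy, hxz, hyz⟩ := three_of_two_lt_encard hcon
    have same : ∀ x ∈ X, ∀ y ∈ X, x ≠ y → (P.filter (· ∈ A x)).card = n →
        (P.filter (· ∈ A y)).card = n → ∀ p ∈ P, p ∈ A x ↔ p ∈ A y := by
      intro x hx y hy hxy hxn hyn p hp
      have : P.filter (· ∈ A x) = P.filter (· ∈ A y) := by
        rcases order x hx y hy hxy with ⟨-, -, h⟩ | ⟨-, -, h⟩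
        · exact Finset.eq_of_subset_of_card_le
            (fun p hp => by simp at hp ⊢; exact ⟨hp.1, h p hp.1 hp.2⟩) (by rw [hxn, hyn])
        · exact (Finset.eq_of_subset_of_card_le
            (fun p hp => by simp at hp ⊢; exact ⟨hp.1, h p hp.1 hp.2⟩) (by rw [hxn, hyn])).symm
      have h2 := Finset.ext_iff.1 this p
      simpa [hp] using h2
    have sxy := same x hx y hy hxy hxn hyn
    have sxz := same x hx z hz hxz hxn hzn
    have syz := same y hy z hz hyz hyn hzn
    have syx := fun p hp => (sxy p hp).symm
    have szx := fun p hp => (sxz p hp).symm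
    have szy := fun p hp => (syz p hp).symm
    -- Among three points of a tournament, one has a predecessor and a successor.
    rcases order x hx y hy hxy with ⟨a1, a2, -⟩ | ⟨a1, a2, -⟩ <;>
    rcases order x hx z hz hxz with ⟨b1, b2, -⟩ | ⟨b1, b2, -⟩ <;>
    rcases order y hy z hz hyz with ⟨c1, c2, -⟩ | ⟨c1, c2, -⟩
    · exact middle x hx y hy z hz hxy hyz.symm syx syz a2 c1
    · exact middle x hx z hz y hy hxz hyz szx szy b2 c2
    · exact middle x hx y hy z hz hxy hyz.symm syx syz a2 c1
    · exact middle z hz x hx y hy hxz.symm hxy.symm sxz sxy b1 a1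
    · exact middle y hy x hx z hz hxy.symm hxz.symm sxy sxz a1 b1
    · exact middle z hz y hy x hx hyz.symm hxy syz syx c1 a2
    · exact middle y hy z hz x hx hyz hxz szy szx c2 b2
    · exact middle z hz y hy x hx hyz.symm hxy syz syx c1 a2

theorem encard_linkIntersections_le {P : Finset Pt} {e f : Pt × Pt} (he : e ∈ hullEdges P)
    (hf : f ∈ hullEdges P) : (linkIntersections P e f).encard ≤ (3 * P.card : ℕ) := by
  refine (Set.encard_le_encard (linkIntersections_subset he hf)).trans
    ((Set.encard_union_le _ _).trans ?_)
  have h := encard_le_of_splits (P := P) (e := e)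
    (X := {x | e ≠ f ∧ x ∈ subChain P e ∧ x ∈ subChain P f ∧ x ∉ P}) (fun x hx => hx.2.2.2) he.2.1
    (fun x hx => exists_rightAngleSplit he hf hx.1 hx.2.1 hx.2.2.1 hx.2.2.2)
  rw [Set.encard_coe_eq_coe_finsetCard]
  refine (add_le_add le_rfl h).trans ?_
  norm_cast
  omega

/-! ### Laminar families and acute splits -/

/-- A laminar family of nonempty subsets of an `n`-element set has at most `2 n` members. -/
theorem card_le_of_laminar {α : Type*} [DecidableEq α] (X : Finset α) :
    ∀ F : Finset (Finset α), (∀ A ∈ F, A ⊆ X ∧ A.Nonempty) →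
      (∀ A ∈ F, ∀ B ∈ F, A ⊆ B ∨ B ⊆ A ∨ Disjoint A B) → F.card ≤ 2 * X.card := by
  induction X using Finset.induction_on with
  | empty =>
    intro F h _
    rw [Finset.eq_empty_of_forall_notMem (s := F) fun A hA => ?_]
    · simp
    · obtain ⟨h1, x, hx⟩ := h A hA
      exact absurd (h1 hx) (by simp)
  | insert x X hx ih =>
    intro F hF hlam
    -- Deleting `x` identifies only one pair `A`, `insert x A` of members.
    let F' := (F.image (·.erase x)).erase ∅
    have hF' : F'.card ≤ 2 * X.card := by
      refine ih F' ?_ ?_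
      · intro A hA
        obtain ⟨hne, hA⟩ := Finset.mem_erase.1 hA
        obtain ⟨B, hB, rfl⟩ := Finset.mem_image.1 hA
        exact ⟨Finset.subset_insert_iff.1 (hF B hB).1,
          Finset.nonempty_iff_ne_empty.2 hne⟩
      · intro A hA B hB
        obtain ⟨A, hAF, rfl⟩ := Finset.mem_image.1 (Finset.mem_erase.1 hA).2
        obtain ⟨B, hBF, rfl⟩ := Finset.mem_image.1 (Finset.mem_erase.1 hB).2
        rcases hlam A hAF B hBF with h | h | h
        · exact Or.inl (Finset.erase_subset_erase x h)
        · exact Or.inr (Or.inl (Finset.erase_subset_erase x h))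
        · exact Or.inr (Or.inr (h.mono (Finset.erase_subset x A) (Finset.erase_subset x B)))
    let G := F.filter fun A => x ∈ A ∧ A.erase x ∈ F
    have hG : G.card ≤ 1 := by
      have key : ∀ A ∈ G, ∀ B ∈ G, A ⊆ B → A = B := by
        intro A hA B hB hAB
        obtain ⟨hAF, hxA, hA'⟩ := Finset.mem_filter.1 hA
        obtain ⟨hBF, hxB, hB'⟩ := Finset.mem_filter.1 hB
        obtain ⟨y, hy⟩ := (hF _ hA').2
        obtain ⟨hyx, hyA⟩ := Finset.mem_erase.1 hy
        rcases hlam A hAF _ hB' with h | h | h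
        · exact absurd (h hxA) (Finset.notMem_erase x B)
        · refine Finset.Subset.antisymm hAB fun z hz => ?_
          by_cases hzx : z = x
          · exact hzx ▸ hxA
          · exact h (Finset.mem_erase.2 ⟨hzx, hz⟩)
        · exact absurd (Finset.mem_erase.2 ⟨hyx, hAB hyA⟩) (Finset.disjoint_left.1 h hyA)
      refine Finset.card_le_one.2 fun A hA B hB => ?_
      have hAF := Finset.mem_filter.1 hA
      have hBF := Finset.mem_filter.1 hB
      rcases hlam A hAF.1 B hBF.1 with h | h | h
      · exact key A hA B hB h
      · exact (key B hB A hA h).symm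
      · exact absurd hBF.2.1 (Finset.disjoint_left.1 h hAF.2.1)
    have hrest : (F \ insert {x} G).card ≤ F'.card := by
      refine Finset.card_le_card_of_injOn (·.erase x) ?_ ?_
      · intro A hA
        obtain ⟨hAF, hA⟩ := Finset.mem_sdiff.1 hA
        refine Finset.mem_erase.2 ⟨fun h => ?_, Finset.mem_image_of_mem _ hAF⟩
        rcases Finset.erase_eq_empty_iff A x |>.1 h with h | h
        · exact (hF A hAF).2.ne_empty h
        · exact hA (Finset.mem_insert.2 (Or.inl h))
      · intro A hA B hB hAB
        obtain ⟨hAF, hA⟩ := Finset.mem_sdiff.1 (Finset.mem_coe.1 hA)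
        obtain ⟨hBF, hB⟩ := Finset.mem_sdiff.1 (Finset.mem_coe.1 hB)
        simp only at hAB
        by_cases hxA : x ∈ A <;> by_cases hxB : x ∈ B
        · rw [← Finset.insert_erase hxA, hAB, Finset.insert_erase hxB]
        · refine absurd (Finset.mem_insert.2 (Or.inr (Finset.mem_filter.2 ⟨hAF, hxA, ?_⟩))) hA
          rw [hAB, Finset.erase_eq_of_notMem hxB]; exact hBF
        · refine absurd (Finset.mem_insert.2 (Or.inr (Finset.mem_filter.2 ⟨hBF, hxB, ?_⟩))) hB
          rw [← hAB, Finset.erase_eq_of_notMem hxA]; exact hAF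
        · rw [← Finset.erase_eq_of_notMem hxA, hAB, Finset.erase_eq_of_notMem hxB]
    have h1 := Finset.card_le_card_sdiff_add_card (s := F) (t := insert {x} G)
    have h2 := Finset.card_insert_le {x} G
    rw [Finset.card_insert_of_notMem hx]
    omega

/-- The set `L` and its complement in `P` form an acute split: the vectors from the complement to
`L` make acute angles with one another. -/
def AcuteSplit (P L : Finset Pt) : Prop :=
  L ⊆ P ∧ L.Nonempty ∧ (∃ q ∈ P, q ∉ L) ∧
    ∀ p ∈ L, ∀ q ∈ L, ∀ r ∈ P, r ∉ L → ∀ s ∈ P, s ∉ L → 0 < dot (p - r) (q - s)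

/-- Two acute splits do not cross: with a point in each of the four intersections, the angle between
the diagonals of the quadrangle would be both acute and obtuse. -/
theorem AcuteSplit.noncrossing {P L M : Finset Pt} (hL : AcuteSplit P L) (hM : AcuteSplit P M)
    {a b c d : Pt} (hb : b ∈ P) (hc : c ∈ P) (hd : d ∈ P)
    (haL : a ∈ L) (haM : a ∈ M) (hbL : b ∈ L) (hbM : b ∉ M) (hcL : c ∉ L) (hcM : c ∉ M)
    (hdL : d ∉ L) (hdM : d ∈ M) : False := by
  have h1 := hL.2.2.2 a haL b hbL c hc hcL d hd hdL
  have h2 := hM.2.2.2 a haM d hdM c hc hcM b hb hbM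
  simp only [dot, PiLp.sub_apply] at h1 h2
  linarith

theorem AcuteSplit.compl [DecidableEq Pt] {P L : Finset Pt} (h : AcuteSplit P L) :
    AcuteSplit P (P \ L) := by
  obtain ⟨h1, ⟨p, hp⟩, ⟨q, hq, hqL⟩, h2⟩ := h
  refine ⟨Finset.sdiff_subset, ⟨q, by simp [hq, hqL]⟩, ⟨p, h1 hp, by simp [hp]⟩, ?_⟩
  intro p hp q hq r hr hrL s hs hsL
  simp only [Finset.mem_sdiff, not_and, not_not] at *
  have := h2 r (hrL hr) s (hsL hs) p hp.1 hp.2 q hq.1 hq.2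
  simp only [dot, PiLp.sub_apply] at *
  linarith

theorem encard_acuteSplit_le (P : Finset Pt) : {L | AcuteSplit P L}.encard ≤ (4 * P.card : ℕ) := by
  classical
  rcases P.eq_empty_or_nonempty with rfl | ⟨o, ho⟩
  · rw [Set.eq_empty_of_forall_notMem (s := {L | AcuteSplit ∅ L})]
    · simp
    · rintro L ⟨h1, ⟨p, hp⟩, -⟩
      exact absurd (h1 hp) (by simp)
  -- Of the two sides of a split, keep the one that does not contain `o`.
  let F := P.powerset.filter fun L => AcuteSplit P L ∧ o ∉ L
  have hF : F.card ≤ 2 * P.card := by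
    refine card_le_of_laminar P F ?_ ?_
    · intro A hA
      have hA := (Finset.mem_filter.1 hA).2
      exact ⟨hA.1.1, hA.1.2.1⟩
    · intro A hA B hB
      obtain ⟨hA, hoA⟩ := (Finset.mem_filter.1 hA).2
      obtain ⟨hB, hoB⟩ := (Finset.mem_filter.1 hB).2
      by_contra! hcon
      obtain ⟨h1, h2, h3⟩ := hcon
      obtain ⟨b, hbA, hbB⟩ := Finset.not_subset.1 h1
      obtain ⟨d, hdB, hdA⟩ := Finset.not_subset.1 h2
      obtain ⟨a, haA, haB⟩ := Finset.not_disjoint_iff.1 h3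
      exact hA.noncrossing hB (hA.1 hbA) ho (hB.1 hdB) haA haB hbA hbB hoA hoB hdA hdB
  have h := encard_le_of_rel (S := {L | AcuteSplit P L}) (T := (↑F : Set (Finset Pt)))
    (fun L A => L = A ∨ L = P \ A) (k := 2) (m := 2 * P.card)
    (by rw [Set.encard_coe_eq_coe_finsetCard]; exact_mod_cast hF) ?_ ?_
  · convert h using 2
    ring
  · intro L hL
    by_cases hoL : o ∈ L
    · refine ⟨P \ L, ?_, Or.inr ?_⟩
      · simp only [F, Finset.coe_filter, Set.mem_ofPred_eq, Finset.mem_powerset]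
        exact ⟨Finset.sdiff_subset, AcuteSplit.compl hL, by simp [hoL]⟩
      · rw [Finset.sdiff_sdiff_eq_self hL.1]
    · refine ⟨L, ?_, Or.inl rfl⟩
      simp only [F, Finset.coe_filter, Set.mem_ofPred_eq, Finset.mem_powerset]
      exact ⟨hL.1, hL, hoL⟩
  · intro A _
    refine (Set.encard_le_encard (t := {A, P \ A}) ?_).trans
      ((Set.encard_insert_le _ _).trans (by rw [Set.encard_singleton]; norm_num))
    rintro L ⟨-, rfl | rfl⟩ <;> simp

/-! ### Free right angles at points of `P` -/

theorem eq_or_eq_of_cross {P : Finset Pt} (hP : GeneralPosition P) {a b c : Pt} (ha : a ∈ P)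
    (hb : b ∈ P) (hc : c ∈ P) (hab : a ≠ b) (h : cross (b - a) (c - a) = 0) : c = a ∨ c = b := by
  by_contra! hne
  refine hP a ha b hb c hc hab hne.1.symm hne.2.symm ?_
  have hv : b - a ≠ 0 := sub_ne_zero.2 hab.symm
  have hpos := dot_self_pos hv
  rw [collinear_iff_of_mem (p₀ := a) (by simp)]
  refine ⟨b - a, ?_⟩
  rintro p (rfl | rfl | rfl)
  · exact ⟨0, by simp⟩
  · exact ⟨1, by simp⟩
  · refine ⟨dot (b - a) (p - a) / dot (b - a) (b - a), ?_⟩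
    have key : ∀ i : Fin 2, p i = dot (b - a) (p - a) / dot (b - a) (b - a) * (b - a) i + a i := by
      intro i
      rw [div_mul_eq_mul_div, ← sub_eq_iff_eq_add, eq_div_iff hpos.ne']
      simp only [dot, cross, PiLp.sub_apply] at *
      fin_cases i
      · simp only [Fin.zero_eta]; linear_combination -(b 1 - a 1) * h
      · simp only [Fin.mk_one]; linear_combination (b 0 - a 0) * h
    ext i
    simpa using key i

/-- The half-open coordinate quadrant which contains the nonzero vector `w`. -/
noncomputable def quadrantIndex (w : Pt) : Fin 4 :=
  if 0 < w 0 ∧ 0 ≤ w 1 then 0 else if w 0 ≤ 0 ∧ 0 < w 1 then 1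
  else if w 0 < 0 ∧ w 1 ≤ 0 then 2 else 3

theorem dot_pos_of_quadrantIndex {v w : Pt} (hv : v ≠ 0) (hw : w ≠ 0)
    (h : quadrantIndex v = quadrantIndex w) : 0 < dot v w := by
  have nz : ∀ u : Pt, u ≠ 0 → u 0 ≠ 0 ∨ u 1 ≠ 0 := by
    intro u hu
    by_contra! h
    exact hu (by ext i; fin_cases i <;> simp [h.1, h.2])
  have cases4 : ∀ u : Pt, u ≠ 0 →
      (0 < u 0 ∧ 0 ≤ u 1 ∧ quadrantIndex u = 0) ∨ (u 0 ≤ 0 ∧ 0 < u 1 ∧ quadrantIndex u = 1) ∨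
      (u 0 < 0 ∧ u 1 ≤ 0 ∧ quadrantIndex u = 2) ∨ (0 ≤ u 0 ∧ u 1 < 0 ∧ quadrantIndex u = 3) := by
    intro u hu
    have := nz u hu
    unfold quadrantIndex
    split_ifs with h1 h2 h3
    · exact Or.inl ⟨h1.1, h1.2, rfl⟩
    · exact Or.inr (Or.inl ⟨h2.1, h2.2, rfl⟩)
    · exact Or.inr (Or.inr (Or.inl ⟨h3.1, h3.2, rfl⟩))
    · refine Or.inr (Or.inr (Or.inr ?_))
      rcases lt_trichotomy (u 0) 0 with ha | ha | ha <;>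
      rcases lt_trichotomy (u 1) 0 with hb | hb | hb <;>
      simp [ha, hb, ha.le, hb.le] at h1 h2 h3 this ⊢
  unfold dot
  rcases cases4 v hv with ⟨a, b, c⟩ | ⟨a, b, c⟩ | ⟨a, b, c⟩ | ⟨a, b, c⟩ <;>
  rcases cases4 w hw with ⟨a', b', c'⟩ | ⟨a', b', c'⟩ | ⟨a', b', c'⟩ | ⟨a', b', c'⟩ <;>
  first
  | (rw [c, c'] at h; exact absurd h (by decide))
  | nlinarith [mul_pos a a', mul_nonneg b b']
  | nlinarith [mul_nonneg_of_nonpos_of_nonpos a a', mul_pos b b']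
  | nlinarith [mul_pos_of_neg_of_neg a a', mul_nonneg_of_nonpos_of_nonpos b b']
  | nlinarith [mul_nonneg a a', mul_pos_of_neg_of_neg b b']

/-- The pairs of points of `P` such that the right-angled sector at the first point, which starts at
the ray through the second point and lies on its left (`ε = 1`) or on its right (`ε = -1`), is free
of points of `P`. -/
def freeSectors (P : Finset Pt) (ε : ℝ) : Set (Pt × Pt) :=
  {d | d.1 ∈ P ∧ d.2 ∈ P ∧ d.1 ≠ d.2 ∧
    ∀ p ∈ P, 0 < dot (d.2 - d.1) (p - d.1) → ε * cross (d.2 - d.1) (p - d.1) ≤ 0}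

/-- The free sectors at one point start in different half-open quadrants. -/
theorem encard_freeSectors_le {P : Finset Pt} (hP : GeneralPosition P) {ε : ℝ} (hε : ε ≠ 0) :
    (freeSectors P ε).encard ≤ (4 * P.card : ℕ) := by
  have h := encard_le_of_rel (S := freeSectors P ε)
    (T := (↑(P ×ˢ (Finset.univ : Finset (Fin 4))) : Set (Pt × Fin 4)))
    (fun d b => d.1 = b.1 ∧ quadrantIndex (d.2 - d.1) = b.2) (k := 1) (m := 4 * P.card)
    (by
      rw [Set.encard_coe_eq_coe_finsetCard, Finset.card_product]
      simp [mul_comm]) ?_ ?_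
  · simpa using h
  · rintro d ⟨h1, -⟩
    exact ⟨(d.1, quadrantIndex (d.2 - d.1)), by simp [h1], rfl, rfl⟩
  · rintro ⟨w, i⟩ -
    rw [Nat.cast_one, Set.encard_le_one_iff]
    rintro ⟨a, b⟩ ⟨a', b'⟩ ⟨⟨h1, h2, h3, h4⟩, h5, h6⟩ ⟨⟨h1', h2', h3', h4'⟩, h5', h6'⟩
    simp only at *
    subst h5
    subst h5'
    have hd := dot_pos_of_quadrantIndex (sub_ne_zero.2 h3.symm) (sub_ne_zero.2 h3'.symm)
      (h6.trans h6'.symm)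
    have k1 := h4 b' h2' hd
    have k2 := h4' b h2 (by rwa [dot_comm])
    have hanti : cross (b' - a') (b - a') = -cross (b - a') (b' - a') := by simp [cross]; ring
    rw [hanti] at k2
    have h0 : cross (b - a') (b' - a') = 0 :=
      (mul_eq_zero.1 (le_antisymm k1 (by linarith))).resolve_left hε
    rcases eq_or_eq_of_cross hP h1 h2 h2' h3 h0 with h | h
    · exact absurd h.symm h3'
    · rw [h]

/-! ### Overlaps as supported splits -/

/-- The set `L` lies strictly to the upper left of its complement in `P`, with respect to the axes
rotated by `φ`. -/
def Separates (P L : Finset Pt) (φ : ℝ) : Prop :=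
  ∀ p ∈ L, ∀ q ∈ P, q ∉ L → xc φ p < xc φ q ∧ yc φ q < yc φ p

/-- The four points of the key are extreme in `L` and in its complement: `u` and `s` are rightmost
and lowest in `L`, `r` and `v` are leftmost and highest in the complement. -/
structure Supports (P L : Finset Pt) (φ : ℝ) (k : OverlapKey) : Prop where
  u_mem : k.u ∈ L
  s_mem : k.s ∈ L
  v_mem : k.v ∈ P
  v_notMem : k.v ∉ L
  r_mem : k.r ∈ P
  r_notMem : k.r ∉ L
  u_max : ∀ p ∈ L, xc φ p ≤ xc φ k.u
  s_min : ∀ p ∈ L, yc φ k.s ≤ yc φ p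
  v_max : ∀ q ∈ P, q ∉ L → yc φ q ≤ yc φ k.v
  r_min : ∀ q ∈ P, q ∉ L → xc φ k.r ≤ xc φ q

/-- The orientation of the first quadrant of a pair of opposite quadrants. -/
noncomputable def orient (i : Fin 2) (θ : ℝ) : ℝ := θ + (i : ℕ) * (Real.pi / 2)

theorem exists_coord (φ s t : ℝ) : ∃ a : Pt, xc φ a = s ∧ yc φ a = t := by
  refine ⟨!₂[s * Real.cos φ - t * Real.sin φ, s * Real.sin φ + t * Real.cos φ], ?_, ?_⟩
  · simp only [xc, Matrix.cons_val_zero, Matrix.cons_val_one]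
    linear_combination s * Real.sin_sq_add_cos_sq φ
  · simp only [yc, Matrix.cons_val_zero, Matrix.cons_val_one]
    linear_combination t * Real.sin_sq_add_cos_sq φ

/-- Two overlapping opposite quadrants split `P` into the points to the upper left and the points to
the lower right of the overlap; the supports are extreme points of the two parts. -/
theorem mem_overlaps_iff {P : Finset Pt} {θ : ℝ} {k : OverlapKey} :
    k ∈ overlaps P θ ↔
      ∃ L ⊆ P, Separates P L (orient k.pair θ) ∧ Supports P L (orient k.pair θ) k := by
  classical
  simp only [overlaps, Set.mem_ofPred_eq]
  rw [show θ + (k.pair : ℕ) * (Real.pi / 2) = orient k.pair θ from rfl]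
  generalize orient k.pair θ = φ
  constructor
  · rintro ⟨a, b, ⟨u1, v1, -, u2, u3, v2, v3, ha⟩, ⟨r1, s1, -, r2, r3, s2, s3, hb⟩, z, za, zb⟩
    simp only [mem_quadrant, inner_xAxis, inner_yAxis, xc_add_pi, yc_add_pi, xc_sub, yc_sub] at *
    have hx : xc φ a < xc φ b := by linarith
    have hy : yc φ a < yc φ b := by linarith
    have ha' : ∀ p ∈ P, xc φ a < xc φ p → yc φ p ≤ yc φ a := fun p hp h => by
      by_contra! h'
      exact ha p hp ⟨by linarith, by linarith⟩
    have hb' : ∀ p ∈ P, xc φ p < xc φ b → yc φ b ≤ yc φ p := fun p hp h => by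
      by_contra! h'
      exact hb p hp ⟨by linarith, by linarith⟩
    have inL : ∀ p ∈ P, xc φ p ≤ xc φ a → yc φ b ≤ yc φ p := fun p hp h => hb' p hp (by linarith)
    have inR : ∀ p ∈ P, xc φ a < xc φ p → yc φ p ≤ yc φ a ∧ xc φ b ≤ xc φ p := fun p hp h => by
      have := ha' p hp h
      refine ⟨this, ?_⟩
      by_contra! h'
      linarith [hb' p hp h']
    have vR : xc φ a < xc φ k.v := by
      by_contra! h
      linarith [inL _ v1 h]
    have sL : xc φ k.s ≤ xc φ a := by
      by_contra! h
      linarith [(inR _ s1 h).1]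
    refine ⟨P.filter fun p => xc φ p ≤ xc φ a, Finset.filter_subset _ _, ?_, ?_⟩
    · intro p hp q hq hqL
      simp only [Finset.mem_filter, hq, true_and, not_le] at hp hqL
      have := inL p hp.1 hp.2
      have := inR q hq hqL
      exact ⟨by linarith, by linarith⟩
    · constructor <;> try simp only [Finset.mem_filter, not_and, not_le]
      · exact ⟨u1, by linarith⟩
      · exact ⟨s1, sL⟩
      · exact v1
      · exact fun _ => vR
      · exact r1
      · exact fun _ => by linarith
      · rintro p ⟨-, hp⟩; linarith
      · rintro p ⟨hp, hp'⟩; linarith [inL p hp hp']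
      · intro q hq h; linarith [inR q hq (h hq)]
      · intro q hq h; linarith [inR q hq (h hq)]
  · rintro ⟨L, hLP, hsep, hs⟩
    obtain ⟨a, hax, hay⟩ := exists_coord φ (xc φ k.u) (yc φ k.v)
    obtain ⟨b, hbx, hby⟩ := exists_coord φ (xc φ k.r) (yc φ k.s)
    obtain ⟨z, hzx, hzy⟩ :=
      exists_coord φ ((xc φ a + xc φ b) / 2) ((yc φ a + yc φ b) / 2)
    have huv := hsep _ hs.u_mem _ hs.v_mem hs.v_notMem
    have hur := hsep _ hs.u_mem _ hs.r_mem hs.r_notMem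
    have hsv := hsep _ hs.s_mem _ hs.v_mem hs.v_notMem
    have hsr := hsep _ hs.s_mem _ hs.r_mem hs.r_notMem
    refine ⟨a, b, ⟨hLP hs.u_mem, hs.v_mem, fun h => hs.v_notMem (h ▸ hs.u_mem), ?_, ?_, ?_, ?_, ?_⟩,
      ⟨hs.r_mem, hLP hs.s_mem, fun h => hs.r_notMem (h ▸ hs.s_mem), ?_, ?_, ?_, ?_, ?_⟩,
      z, ?_, ?_⟩
    all_goals
      simp only [mem_quadrant, inner_xAxis, inner_yAxis, xc_add_pi, yc_add_pi, xc_sub, yc_sub]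
    · linarith
    · linarith
    · linarith
    · linarith
    · rintro p hp ⟨h1, h2⟩
      by_cases hpL : p ∈ L
      · linarith [hs.u_max p hpL]
      · linarith [hs.v_max p hp hpL]
    · linarith
    · linarith
    · linarith
    · linarith
    · rintro p hp ⟨h1, h2⟩
      by_cases hpL : p ∈ L
      · linarith [hs.s_min p hpL]
      · linarith [hs.r_min p hp hpL]
    · constructor <;> linarith
    · constructor <;> linarith

theorem Separates.acuteSplit {P L : Finset Pt} {φ : ℝ} {k : OverlapKey} (hLP : L ⊆ P)
    (h : Separates P L φ) (hs : Supports P L φ k) : AcuteSplit P L := by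
  refine ⟨hLP, ⟨_, hs.u_mem⟩, ⟨_, hs.v_mem, hs.v_notMem⟩, ?_⟩
  intro p hp q hq r hr hrL s hs hsL
  have h1 := h p hp r hr hrL
  have h2 := h q hq s hs hsL
  rw [dot_eq φ]
  simp only [xc_sub, yc_sub]
  exact add_pos (mul_pos_of_neg_of_neg (by linarith) (by linarith))
    (mul_pos (by linarith) (by linarith))

/-- On a line of the plane there are at most two points of `P`. -/
theorem encard_le_two_of_const {P : Finset Pt} (hP : GeneralPosition P) {S : Set Pt} {φ : ℝ}
    (hS : S ⊆ P) (h : (∀ a ∈ S, ∀ b ∈ S, xc φ a = xc φ b) ∨ ∀ a ∈ S, ∀ b ∈ S, yc φ a = yc φ b) :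
    S.encard ≤ (2 : ℕ) := by
  by_contra hcon
  obtain ⟨a, ha, b, hb, c, hc, hab, hac, hbc⟩ := three_of_two_lt_encard hcon
  have h0 : cross (b - a) (c - a) = 0 := by
    rw [cross_eq φ]
    simp only [xc_sub, yc_sub]
    rcases h with h | h
    · rw [h b hb a ha, h c hc a ha]; ring
    · rw [h b hb a ha, h c hc a ha]; ring
  rcases eq_or_eq_of_cross hP (hS ha) (hS hb) (hS hc) hab h0 with h | h
  · exact hac h.symm
  · exact hbc h.symm

theorem encard_supports_le {P L : Finset Pt} (hP : GeneralPosition P) (hLP : L ⊆ P) (i : Fin 2)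
    (φ : ℝ) : {k : OverlapKey | k.pair = i ∧ Supports P L φ k}.encard ≤ (16 : ℕ) := by
  let U : Set Pt := {u | u ∈ L ∧ ∀ p ∈ L, xc φ p ≤ xc φ u}
  let S : Set Pt := {s | s ∈ L ∧ ∀ p ∈ L, yc φ s ≤ yc φ p}
  let V : Set Pt := {v | v ∈ P ∧ v ∉ L ∧ ∀ q ∈ P, q ∉ L → yc φ q ≤ yc φ v}
  let R : Set Pt := {r | r ∈ P ∧ r ∉ L ∧ ∀ q ∈ P, q ∉ L → xc φ r ≤ xc φ q}
  have hU : U.encard ≤ (2 : ℕ) := encard_le_two_of_const (φ := φ) hP (fun u hu => hLP hu.1)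
    (Or.inl fun a ha b hb => le_antisymm (hb.2 a ha.1) (ha.2 b hb.1))
  have hS : S.encard ≤ (2 : ℕ) := encard_le_two_of_const (φ := φ) hP (fun u hu => hLP hu.1)
    (Or.inr fun a ha b hb => le_antisymm (ha.2 b hb.1) (hb.2 a ha.1))
  have hV : V.encard ≤ (2 : ℕ) := encard_le_two_of_const (φ := φ) hP (fun u hu => hu.1)
    (Or.inr fun a ha b hb => le_antisymm (hb.2.2 a ha.1 ha.2.1) (ha.2.2 b hb.1 hb.2.1))
  have hR : R.encard ≤ (2 : ℕ) := encard_le_two_of_const (φ := φ) hP (fun u hu => hu.1)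
    (Or.inl fun a ha b hb => le_antisymm (ha.2.2 b hb.1 hb.2.1) (hb.2.2 a ha.1 ha.2.1))
  have hsub : {k : OverlapKey | k.pair = i ∧ Supports P L φ k} ⊆
      (fun t : (Pt × Pt) × Pt × Pt => (⟨i, t.1.1, t.1.2, t.2.1, t.2.2⟩ : OverlapKey)) ''
        ((U ×ˢ V) ×ˢ R ×ˢ S) := by
    rintro ⟨j, u, v, r, s⟩ ⟨rfl, h⟩
    exact ⟨((u, v), r, s), ⟨⟨⟨h.u_mem, h.u_max⟩, h.v_mem, h.v_notMem, h.v_max⟩,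
      ⟨h.r_mem, h.r_notMem, h.r_min⟩, h.s_mem, h.s_min⟩, rfl⟩
  refine (Set.encard_le_encard hsub).trans ((Set.encard_image_le _ _).trans ?_)
  rw [Set.encard_prod, Set.encard_prod, Set.encard_prod]
  exact (mul_le_mul' (mul_le_mul' hU hV) (mul_le_mul' hR hS)).trans (by norm_num)

/-! ### Ties and contacts -/

/-- Two points tie for the role of the point `u`, `s`, `v`, `r` (for `j = 0, 1, 2, 3`) at the angle
`φ`; they are ordered such that the second one lies on a bounding ray of the extremal quadrant
translated to the first one. -/
def Tied (P L : Finset Pt) (φ : ℝ) (j : Fin 4) (w z : Pt) : Prop :=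
  match j with
  | 0 => w ∈ L ∧ z ∈ L ∧ (∀ p ∈ L, xc φ p ≤ xc φ w) ∧ xc φ z = xc φ w ∧ yc φ w < yc φ z
  | 1 => w ∈ L ∧ z ∈ L ∧ (∀ p ∈ L, yc φ w ≤ yc φ p) ∧ yc φ z = yc φ w ∧ xc φ z < xc φ w
  | 2 => w ∈ P \ L ∧ z ∈ P \ L ∧ (∀ q ∈ P, q ∉ L → yc φ q ≤ yc φ w) ∧ yc φ z = yc φ w ∧
      xc φ w < xc φ z
  | 3 => w ∈ P \ L ∧ z ∈ P \ L ∧ (∀ q ∈ P, q ∉ L → xc φ w ≤ xc φ q) ∧ xc φ z = xc φ w ∧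
      yc φ z < yc φ w

theorem Tied.mem_freeSectors {P L : Finset Pt} {φ : ℝ} {j : Fin 4} {w z : Pt} (hLP : L ⊆ P)
    (hsep : Separates P L φ) (h : Tied P L φ j w z) :
    (w, z) ∈ freeSectors P 1 ∪ freeSectors P (-1) := by
  have hne : w ≠ z := by
    rintro rfl
    fin_cases j <;> exact lt_irrefl _ h.2.2.2.2
  match j, h with
  | 0, h =>
    obtain ⟨hw, hz, hmax, hx, hy⟩ := h
    refine Or.inr ⟨hLP hw, hLP hz, hne, fun p hp h1 => ?_⟩
    rw [dot_eq φ] at h1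
    rw [cross_eq φ]
    simp only [xc_sub, yc_sub, hx, sub_self, zero_mul, zero_add] at h1 ⊢
    have h2 := (pos_iff_pos_of_mul_pos h1).1 (sub_pos.2 hy)
    have h3 : xc φ p ≤ xc φ w := by
      by_cases hpL : p ∈ L
      · exact hmax p hpL
      · linarith [hsep w hw p hp hpL]
    have := mul_nonneg (sub_pos.2 hy).le (sub_nonneg.2 h3)
    linarith
  | 1, h =>
    obtain ⟨hw, hz, hmax, hx, hy⟩ := h
    refine Or.inl ⟨hLP hw, hLP hz, hne, fun p hp h1 => ?_⟩
    rw [dot_eq φ] at h1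
    rw [cross_eq φ]
    simp only [xc_sub, yc_sub, hx, sub_self, zero_mul, add_zero] at h1 ⊢
    have h3 : yc φ w ≤ yc φ p := by
      by_cases hpL : p ∈ L
      · exact hmax p hpL
      · have := hsep w hw p hp hpL
        nlinarith
    have := mul_nonneg (sub_pos.2 hy).le (sub_nonneg.2 h3)
    linarith
  | 2, h =>
    obtain ⟨hw, hz, hmax, hx, hy⟩ := h
    simp only [Finset.mem_sdiff] at hw hz
    refine Or.inl ⟨hw.1, hz.1, hne, fun p hp h1 => ?_⟩
    rw [dot_eq φ] at h1
    rw [cross_eq φ]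
    simp only [xc_sub, yc_sub, hx, sub_self, zero_mul, add_zero] at h1 ⊢
    have h3 : yc φ p ≤ yc φ w := by
      by_cases hpL : p ∈ L
      · have := hsep p hpL w hw.1 hw.2
        nlinarith
      · exact hmax p hp hpL
    have := mul_nonneg (sub_pos.2 hy).le (sub_nonneg.2 h3)
    linarith
  | 3, h =>
    obtain ⟨hw, hz, hmax, hx, hy⟩ := h
    simp only [Finset.mem_sdiff] at hw hz
    refine Or.inr ⟨hw.1, hz.1, hne, fun p hp h1 => ?_⟩
    rw [dot_eq φ] at h1
    rw [cross_eq φ]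
    simp only [xc_sub, yc_sub, hx, sub_self, zero_mul, zero_add] at h1 ⊢
    have h3 : xc φ w ≤ xc φ p := by
      by_cases hpL : p ∈ L
      · have := hsep p hpL w hw.1 hw.2
        nlinarith
      · exact hmax p hp hpL
    have := mul_nonneg (sub_pos.2 hy).le (sub_nonneg.2 h3)
    linarith

/-- Within a full turn, an orientation is determined by the direction of one of its axes. -/
theorem eq_of_parallel {i : Fin 2} {θ θ' : ℝ} (hθ : θ ∈ Set.Ico 0 (2 * Real.pi))
    (hθ' : θ' ∈ Set.Ico 0 (2 * Real.pi)) {d : Pt}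
    (h : (xc (orient i θ) d = 0 ∧ xc (orient i θ') d = 0 ∧
        0 < yc (orient i θ) d * yc (orient i θ') d) ∨
      (yc (orient i θ) d = 0 ∧ yc (orient i θ') d = 0 ∧
        0 < xc (orient i θ) d * xc (orient i θ') d)) : θ = θ' := by
  have hcs := Real.sin_sq_add_cos_sq (orient i θ' - orient i θ)
  have e1 : orient i θ' - orient i θ = θ' - θ := by simp [orient]
  rw [xc_change (orient i θ) (orient i θ'), yc_change (orient i θ) (orient i θ')] at h
  rw [e1] at h hcs
  have hcos : Real.cos (θ' - θ) = 1 := by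
    rcases h with ⟨h1, h2, h3⟩ | ⟨h1, h2, h3⟩
    · rw [h1] at h2 h3
      have hy : yc (orient i θ) d ≠ 0 := fun h => by simp [h] at h3
      have hs : Real.sin (θ' - θ) = 0 := (mul_eq_zero.1 (by linarith)).resolve_right hy
      rw [hs] at hcs
      have : 0 < Real.cos (θ' - θ) := by
        by_contra! hc
        nlinarith [mul_nonpos_of_nonpos_of_nonneg hc (mul_self_nonneg (yc (orient i θ) d))]
      nlinarith
    · rw [h1] at h2 h3
      have hy : xc (orient i θ) d ≠ 0 := fun h => by simp [h] at h3
      have hs : Real.sin (θ' - θ) = 0 := (mul_eq_zero.1 (by linarith)).resolve_right hy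
      rw [hs] at hcs
      have : 0 < Real.cos (θ' - θ) := by
        by_contra! hc
        nlinarith [mul_nonpos_of_nonpos_of_nonneg hc (mul_self_nonneg (xc (orient i θ) d))]
      nlinarith
  rw [Real.cos_eq_one_iff_of_lt_of_lt (by linarith [hθ.2, hθ'.1]) (by linarith [hθ.1, hθ'.2])]
    at hcos
  linarith

/-- The angles, pairs of quadrants and splits at which an overlap has two candidates for one of its
supports. -/
def tieEvents (P : Finset Pt) : Set (ℝ × Fin 2 × Finset Pt) :=
  {x | x.1 ∈ Set.Ico 0 (2 * Real.pi) ∧ x.2.2 ⊆ P ∧ Separates P x.2.2 (orient x.2.1 x.1) ∧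
    ∃ j w z, Tied P x.2.2 (orient x.2.1 x.1) j w z}

/-- The tied points determine the angle, and then the split. -/
theorem encard_tieEvents_le {P : Finset Pt} (hP : GeneralPosition P) :
    (tieEvents P).encard ≤ (64 * P.card : ℕ) := by
  have hT : ((Set.univ : Set (Fin 2 × Fin 4)) ×ˢ (freeSectors P 1 ∪ freeSectors P (-1))).encard ≤
      (64 * P.card : ℕ) := by
    rw [Set.encard_prod, Set.encard_univ]
    have h1 := encard_freeSectors_le hP (ε := 1) one_ne_zero
    have h2 := encard_freeSectors_le hP (ε := -1) (by norm_num)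
    have h3 := (Set.encard_union_le _ _).trans (add_le_add h1 h2)
    refine (mul_le_mul' le_rfl h3).trans ?_
    simp only [ENat.card_eq_coe_fintype_card, Fintype.card_prod, Fintype.card_fin]
    norm_cast
    omega
  have h := encard_le_of_rel (S := tieEvents P)
    (fun x t => x.2.1 = t.1.1 ∧ Tied P x.2.2 (orient x.2.1 x.1) t.1.2 t.2.1 t.2.2) (k := 1) hT ?_ ?_
  · simpa using h
  · rintro ⟨θ, i, L⟩ ⟨-, hLP, hsep, j, w, z, h⟩
    exact ⟨((i, j), w, z), ⟨Set.mem_univ _, h.mem_freeSectors hLP hsep⟩, rfl, h⟩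
  · rintro ⟨⟨i, j⟩, w, z⟩ -
    rw [Nat.cast_one, Set.encard_le_one_iff]
    rintro ⟨θ, i', L⟩ ⟨θ', i'', L'⟩ ⟨⟨hθ, hL, hsep, -⟩, rfl, ht⟩ ⟨⟨hθ', hL', hsep', -⟩, h0, ht'⟩
    simp only at *
    subst h0
    have hang : θ = θ' := by
      refine eq_of_parallel (i := i'') hθ hθ' (d := z - w) ?_
      simp only [xc_sub, yc_sub]
      match j, ht, ht' with
      | 0, ⟨_, _, _, h1, h2⟩, ⟨_, _, _, h3, h4⟩ =>
        exact Or.inl ⟨by linarith, by linarith, mul_pos (by linarith) (by linarith)⟩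
      | 1, ⟨_, _, _, h1, h2⟩, ⟨_, _, _, h3, h4⟩ =>
        exact Or.inr ⟨by linarith, by linarith, mul_pos_of_neg_of_neg (by linarith) (by linarith)⟩
      | 2, ⟨_, _, _, h1, h2⟩, ⟨_, _, _, h3, h4⟩ =>
        exact Or.inr ⟨by linarith, by linarith, mul_pos (by linarith) (by linarith)⟩
      | 3, ⟨_, _, _, h1, h2⟩, ⟨_, _, _, h3, h4⟩ =>
        exact Or.inl ⟨by linarith, by linarith, mul_pos_of_neg_of_neg (by linarith) (by linarith)⟩
    subst hang
    generalize orient i'' θ = φ at *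
    have hsub : ∀ L L' : Finset Pt, L ⊆ P → Separates P L φ → Separates P L' φ →
        Tied P L φ j w z → Tied P L' φ j w z → L ⊆ L' := by
      intro L L' hL hsep hsep' ht ht' p hp
      by_contra hp'
      match j, ht, ht' with
      | 0, ⟨_, _, h1, _⟩, ⟨hw, _⟩ => linarith [h1 p hp, hsep' w hw p (hL hp) hp']
      | 1, ⟨_, _, h1, _⟩, ⟨hw, _⟩ => linarith [h1 p hp, hsep' w hw p (hL hp) hp']
      | 2, ⟨hw, _⟩, ⟨_, _, h1, _⟩ =>
        simp only [Finset.mem_sdiff] at hw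
        linarith [h1 p (hL hp) hp', hsep p hp w hw.1 hw.2]
      | 3, ⟨hw, _⟩, ⟨_, _, h1, _⟩ =>
        simp only [Finset.mem_sdiff] at hw
        linarith [h1 p (hL hp) hp', hsep p hp w hw.1 hw.2]
    rw [Finset.Subset.antisymm (hsub L L' hL hsep hsep' ht ht')
      (hsub L' L hL' hsep' hsep ht' ht)]

/-- The angles, pairs of quadrants and acute splits at which the two parts of the split come into
contact: they are still separated weakly, but no longer strictly. -/
def contactEvents (P : Finset Pt) : Set (ℝ × Fin 2 × Finset Pt) :=
  {x | x.1 ∈ Set.Ico 0 (2 * Real.pi) ∧ AcuteSplit P x.2.2 ∧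
    (∀ p ∈ x.2.2, ∀ q ∈ P, q ∉ x.2.2 → xc (orient x.2.1 x.1) p ≤ xc (orient x.2.1 x.1) q ∧
      yc (orient x.2.1 x.1) q ≤ yc (orient x.2.1 x.1) p) ∧
    ∃ p ∈ x.2.2, ∃ q ∈ P, q ∉ x.2.2 ∧ (xc (orient x.2.1 x.1) p = xc (orient x.2.1 x.1) q ∨
      yc (orient x.2.1 x.1) p = yc (orient x.2.1 x.1) q)}

/-- A split comes into contact at most twice for either pair: the vector joining the points in
contact is extreme among the vectors between the two parts, on the one or on the other side. -/
theorem encard_contactEvents_le (P : Finset Pt) :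
    (contactEvents P).encard ≤ (16 * P.card : ℕ) := by
  have hT : ((Set.univ : Set (Fin 2 × Bool)) ×ˢ {L | AcuteSplit P L}).encard ≤
      (16 * P.card : ℕ) := by
    rw [Set.encard_prod, Set.encard_univ]
    refine (mul_le_mul' le_rfl (encard_acuteSplit_le P)).trans ?_
    simp only [ENat.card_eq_coe_fintype_card, Fintype.card_prod, Fintype.card_fin,
      Fintype.card_bool]
    norm_cast
    omega
  have h := encard_le_of_rel (S := contactEvents P)
    (fun x t => x.2.1 = t.1.1 ∧ x.2.2 = t.2 ∧ ∃ p ∈ x.2.2, ∃ q ∈ P, q ∉ x.2.2 ∧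
      bif t.1.2 then xc (orient x.2.1 x.1) p = xc (orient x.2.1 x.1) q
        else yc (orient x.2.1 x.1) p = yc (orient x.2.1 x.1) q) (k := 1) hT ?_ ?_
  · simpa using h
  · rintro ⟨θ, i, L⟩ ⟨-, hL, -, p, hp, q, hq, hqL, h | h⟩
    · exact ⟨((i, true), L), ⟨Set.mem_univ _, hL⟩, rfl, rfl, p, hp, q, hq, hqL, by simpa using h⟩
    · exact ⟨((i, false), L), ⟨Set.mem_univ _, hL⟩, rfl, rfl, p, hp, q, hq, hqL, by simpa using h⟩
  · rintro ⟨⟨i, j⟩, L⟩ -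
    rw [Nat.cast_one, Set.encard_le_one_iff]
    rintro ⟨θ, i', L'⟩ ⟨θ', i'', L''⟩ ⟨⟨hθ, hL, hsep, -⟩, rfl, rfl, p, hp, q, hq, hqL, ht⟩
      ⟨⟨hθ', -, hsep', -⟩, h0, h0', p', hp', q', hq', hqL', ht'⟩
    simp only at *
    subst h0
    subst h0'
    have a1 := hsep p hp q hq hqL
    have a2 := hsep p' hp' q' hq' hqL'
    have b1 := hsep' p hp q hq hqL
    have b2 := hsep' p' hp' q' hq' hqL'
    have acute := hL.2.2.2 p hp p' hp' q hq hqL q' hq' hqL'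
    have acute2 := hL.2.2.2 p hp p hp q hq hqL q hq hqL
    have cr1 := cross_eq (orient i'' θ) (p - q) (p' - q')
    have cr2 := cross_eq (orient i'' θ') (p - q) (p' - q')
    -- The two contact vectors are parallel: each is extreme at its own angle.
    have key : cross (p - q) (p' - q') = 0 := by
      simp only [xc_sub, yc_sub] at cr1 cr2
      cases j
      · simp only [cond_false] at ht ht'
        refine le_antisymm ?_ ?_
        · rw [cr1, ht]
          nlinarith [mul_nonneg (sub_nonneg.2 a1.1) (sub_nonneg.2 a2.2)]
        · rw [cr2, ht']
          nlinarith [mul_nonneg (sub_nonneg.2 b2.1) (sub_nonneg.2 b1.2)]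
      · simp only [cond_true] at ht ht'
        refine le_antisymm ?_ ?_
        · rw [cr2, ht']
          nlinarith [mul_nonneg (sub_nonneg.2 b1.1) (sub_nonneg.2 b2.2)]
        · rw [cr1, ht]
          nlinarith [mul_nonneg (sub_nonneg.2 a2.1) (sub_nonneg.2 a1.2)]
    have hang : θ = θ' := by
      refine eq_of_parallel (i := i'') hθ hθ' (d := p - q) ?_
      rw [cr2] at key
      rw [dot_eq (orient i'' θ')] at acute
      have d1 := acute2
      have d2 := acute2
      rw [dot_eq (orient i'' θ)] at d1
      rw [dot_eq (orient i'' θ')] at d2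
      simp only [xc_sub, yc_sub] at *
      cases j
      · simp only [cond_false] at ht ht'
        right
        have h1 : yc (orient i'' θ) p - yc (orient i'' θ) q = 0 := by linarith
        have h2 : yc (orient i'' θ') p' - yc (orient i'' θ') q' = 0 := by linarith
        rw [h2, mul_zero, zero_sub, neg_eq_zero] at key
        rw [h2, mul_zero, add_zero] at acute
        have h3 := (mul_eq_zero.1 key).resolve_right fun h => by simp [h] at acute
        rw [h1, mul_zero, add_zero] at d1
        rw [h3, mul_zero, add_zero] at d2
        exact ⟨h1, h3, mul_pos_of_neg_of_neg
          (lt_of_le_of_ne (by linarith) fun h => by simp [h] at d1)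
          (lt_of_le_of_ne (by linarith) fun h => by simp [h] at d2)⟩
      · simp only [cond_true] at ht ht'
        left
        have h1 : xc (orient i'' θ) p - xc (orient i'' θ) q = 0 := by linarith
        have h2 : xc (orient i'' θ') p' - xc (orient i'' θ') q' = 0 := by linarith
        rw [h2, mul_zero, sub_zero] at key
        rw [h2, mul_zero, zero_add] at acute
        have h3 := (mul_eq_zero.1 key).resolve_right fun h => by simp [h] at acute
        rw [h1, mul_zero, zero_add] at d1
        rw [h3, mul_zero, zero_add] at d2
        exact ⟨h1, h3, mul_pos
          (lt_of_le_of_ne (by linarith) fun h => by simp [← h] at d1)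
          (lt_of_le_of_ne (by linarith) fun h => by simp [← h] at d2)⟩
    rw [hang]

/-! ### Events -/

theorem continuous_xc (i : Fin 2) (p : Pt) : Continuous fun θ => xc (orient i θ) p := by
  unfold xc orient; fun_prop

theorem continuous_yc (i : Fin 2) (p : Pt) : Continuous fun θ => yc (orient i θ) p := by
  unfold yc orient; fun_prop

/-- Without ties, an overlap persists. -/
theorem eventually_mem_overlaps {P L : Finset Pt} {θ : ℝ} {k : OverlapKey} (hLP : L ⊆ P)
    (hsep : Separates P L (orient k.pair θ)) (hs : Supports P L (orient k.pair θ) k)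
    (htie : ∀ j w z, ¬ Tied P L (orient k.pair θ) j w z) : ∀ᶠ t in 𝓝 θ, k ∈ overlaps P t := by
  classical
  have ltx : ∀ p q, xc (orient k.pair θ) p < xc (orient k.pair θ) q →
      ∀ᶠ t in 𝓝 θ, xc (orient k.pair t) p < xc (orient k.pair t) q := fun p q h =>
    (continuous_xc k.pair p).continuousAt.eventually_lt (continuous_xc k.pair q).continuousAt h
  have lty : ∀ p q, yc (orient k.pair θ) p < yc (orient k.pair θ) q →
      ∀ᶠ t in 𝓝 θ, yc (orient k.pair t) p < yc (orient k.pair t) q := fun p q h =>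
    (continuous_yc k.pair p).continuousAt.eventually_lt (continuous_yc k.pair q).continuousAt h
  have hu : ∀ p ∈ L, ∀ᶠ t in 𝓝 θ, xc (orient k.pair t) p ≤ xc (orient k.pair t) k.u := by
    intro p hp
    by_cases hpu : p = k.u
    · exact Eventually.of_forall fun t => by rw [hpu]
    refine (ltx p k.u (lt_of_le_of_ne (hs.u_max p hp) fun h => ?_)).mono fun _ h => h.le
    rcases lt_trichotomy (yc (orient k.pair θ) p) (yc (orient k.pair θ) k.u) with h' | h' | h'
    · exact htie 0 p k.u ⟨hp, hs.u_mem, fun q hq => h ▸ hs.u_max q hq, h.symm, h'⟩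
    · exact hpu (ext_coord _ h h')
    · exact htie 0 k.u p ⟨hs.u_mem, hp, hs.u_max, h, h'⟩
  have hv : ∀ p ∈ P, p ∉ L → ∀ᶠ t in 𝓝 θ, yc (orient k.pair t) p ≤ yc (orient k.pair t) k.v := by
    intro p hp hpL
    by_cases hpu : p = k.v
    · exact Eventually.of_forall fun t => by rw [hpu]
    have hp' : p ∈ P \ L := Finset.mem_sdiff.2 ⟨hp, hpL⟩
    have hv' : k.v ∈ P \ L := Finset.mem_sdiff.2 ⟨hs.v_mem, hs.v_notMem⟩
    refine (lty p k.v (lt_of_le_of_ne (hs.v_max p hp hpL) fun h => ?_)).mono fun _ h => h.le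
    rcases lt_trichotomy (xc (orient k.pair θ) p) (xc (orient k.pair θ) k.v) with h' | h' | h'
    · exact htie 2 p k.v ⟨by convert hp', by convert hv',
        fun q hq hqL => h ▸ hs.v_max q hq hqL, h.symm, h'⟩
    · exact hpu (ext_coord _ h' h)
    · exact htie 2 k.v p ⟨by convert hv', by convert hp', hs.v_max, h, h'⟩
  have hss : ∀ p ∈ L, ∀ᶠ t in 𝓝 θ, yc (orient k.pair t) k.s ≤ yc (orient k.pair t) p := by
    intro p hp
    by_cases hpu : p = k.s
    · exact Eventually.of_forall fun t => by rw [hpu]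
    refine (lty k.s p (lt_of_le_of_ne (hs.s_min p hp) fun h => ?_)).mono fun _ h => h.le
    rcases lt_trichotomy (xc (orient k.pair θ) p) (xc (orient k.pair θ) k.s) with h' | h' | h'
    · exact htie 1 k.s p ⟨hs.s_mem, hp, hs.s_min, h.symm, h'⟩
    · exact hpu (ext_coord _ h' h.symm)
    · exact htie 1 p k.s ⟨hp, hs.s_mem, fun q hq => h ▸ hs.s_min q hq, h, h'⟩
  have hr : ∀ p ∈ P, p ∉ L → ∀ᶠ t in 𝓝 θ, xc (orient k.pair t) k.r ≤ xc (orient k.pair t) p := by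
    intro p hp hpL
    by_cases hpu : p = k.r
    · exact Eventually.of_forall fun t => by rw [hpu]
    have hp' : p ∈ P \ L := Finset.mem_sdiff.2 ⟨hp, hpL⟩
    have hr' : k.r ∈ P \ L := Finset.mem_sdiff.2 ⟨hs.r_mem, hs.r_notMem⟩
    refine (ltx k.r p (lt_of_le_of_ne (hs.r_min p hp hpL) fun h => ?_)).mono fun _ h => h.le
    rcases lt_trichotomy (yc (orient k.pair θ) p) (yc (orient k.pair θ) k.r) with h' | h' | h'
    · exact htie 3 k.r p ⟨by convert hr', by convert hp', hs.r_min, h.symm, h'⟩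
    · exact hpu (ext_coord _ h.symm h')
    · exact htie 3 p k.r ⟨by convert hp', by convert hr',
        fun q hq hqL => h ▸ hs.r_min q hq hqL, h, h'⟩
  have hsep' : ∀ p ∈ L, ∀ q ∈ P, q ∉ L → ∀ᶠ t in 𝓝 θ,
      xc (orient k.pair t) p < xc (orient k.pair t) q ∧
        yc (orient k.pair t) q < yc (orient k.pair t) p := fun p hp q hq hqL =>
    (ltx p q (hsep p hp q hq hqL).1).and (lty q p (hsep p hp q hq hqL).2)
  have key := (((((eventually_all_finset L).2 hu).and ((eventually_all_finset L).2 hss)).and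
    ((eventually_all_finset P).2 fun p hp => eventually_imp_distrib_left.2 (hv p hp))).and
    ((eventually_all_finset P).2 fun p hp => eventually_imp_distrib_left.2 (hr p hp))).and
    ((eventually_all_finset L).2 fun p hp => (eventually_all_finset P).2 fun q hq =>
      eventually_imp_distrib_left.2 (hsep' p hp q hq))
  filter_upwards [key] with t ht
  obtain ⟨⟨⟨⟨h1, h2⟩, h3⟩, h4⟩, h5⟩ := ht
  exact mem_overlaps_iff.2 ⟨L, hLP, h5, ⟨hs.u_mem, hs.s_mem, hs.v_mem, hs.v_notMem, hs.r_mem,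
    hs.r_notMem, h1, h2, h3, h4⟩⟩

theorem le_of_frequently_le {f g : ℝ → ℝ} (hf : Continuous f) (hg : Continuous g) {θ : ℝ}
    (h : ∃ᶠ t in 𝓝 θ, f t ≤ g t) : f θ ≤ g θ := by
  by_contra! hlt
  refine h ((hg.continuousAt.eventually_lt hf.continuousAt hlt).mono fun t ht => not_le.2 ht)

/-- The angles with an overlap whose presence changes there. -/
def changes (P : Finset Pt) : Set (ℝ × OverlapKey) :=
  {ev | ev.1 ∈ Set.Ico 0 (2 * Real.pi) ∧
    ((ev.2 ∈ overlaps P ev.1 ∧ ∃ᶠ t in 𝓝 ev.1, ev.2 ∉ overlaps P t) ∨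
      (ev.2 ∉ overlaps P ev.1 ∧ ∃ᶠ t in 𝓝 ev.1, ev.2 ∈ overlaps P t))}

/-- The presence of an overlap changes at a tie, if it is present, and at a contact otherwise. -/
theorem exists_event_of_change {P : Finset Pt} {θ : ℝ} {k : OverlapKey}
    (h : (θ, k) ∈ changes P) : ∃ L, (θ, k.pair, L) ∈ tieEvents P ∪ contactEvents P ∧
      L ⊆ P ∧ Supports P L (orient k.pair θ) k := by
  classical
  obtain ⟨hθ, ⟨hk, hf⟩ | ⟨hk, hf⟩⟩ := h
  · obtain ⟨L, hLP, hsep, hs⟩ := mem_overlaps_iff.1 hk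
    refine ⟨L, Or.inl ⟨hθ, hLP, hsep, ?_⟩, hLP, hs⟩
    by_contra! htie
    exact hf ((eventually_mem_overlaps hLP hsep hs htie).mono fun t ht => not_not.2 ht)
  · obtain ⟨L, hLP, hL⟩ : ∃ L ⊆ P, ∃ᶠ t in 𝓝 θ, Separates P L (orient k.pair t) ∧
        Supports P L (orient k.pair t) k := by
      by_contra! hcon
      have : ∀ᶠ t in 𝓝 θ, ∀ L ∈ P.powerset, ¬ (Separates P L (orient k.pair t) ∧
          Supports P L (orient k.pair t) k) :=
        (eventually_all_finset _).2 fun L hL =>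
          (hcon L (Finset.mem_powerset.1 hL)).mono fun _ h1 h2 => h1 h2.1 h2.2
      refine hf (this.mono fun t ht hk => ?_)
      obtain ⟨L, hLP, h1⟩ := mem_overlaps_iff.1 hk
      exact ht L (Finset.mem_powerset.2 hLP) h1
    obtain ⟨t, ht1, ht2⟩ := hL.exists
    have hlex : ∀ p q, (∃ᶠ t in 𝓝 θ, xc (orient k.pair t) p ≤ xc (orient k.pair t) q) →
        xc (orient k.pair θ) p ≤ xc (orient k.pair θ) q := fun p q =>
      le_of_frequently_le (continuous_xc k.pair p) (continuous_xc k.pair q)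
    have hley : ∀ p q, (∃ᶠ t in 𝓝 θ, yc (orient k.pair t) p ≤ yc (orient k.pair t) q) →
        yc (orient k.pair θ) p ≤ yc (orient k.pair θ) q := fun p q =>
      le_of_frequently_le (continuous_yc k.pair p) (continuous_yc k.pair q)
    have hsupp : Supports P L (orient k.pair θ) k :=
      ⟨ht2.u_mem, ht2.s_mem, ht2.v_mem, ht2.v_notMem, ht2.r_mem, ht2.r_notMem,
        fun p hp => hlex _ _ (hL.mono fun t ht => ht.2.u_max p hp),
        fun p hp => hley _ _ (hL.mono fun t ht => ht.2.s_min p hp),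
        fun p hp hpL => hley _ _ (hL.mono fun t ht => ht.2.v_max p hp hpL),
        fun p hp hpL => hlex _ _ (hL.mono fun t ht => ht.2.r_min p hp hpL)⟩
    have hweak : ∀ p ∈ L, ∀ q ∈ P, q ∉ L → xc (orient k.pair θ) p ≤ xc (orient k.pair θ) q ∧
        yc (orient k.pair θ) q ≤ yc (orient k.pair θ) p := fun p hp q hq hqL =>
      ⟨hlex _ _ (hL.mono fun t ht => (ht.1 p hp q hq hqL).1.le),
        hley _ _ (hL.mono fun t ht => (ht.1 p hp q hq hqL).2.le)⟩
    refine ⟨L, Or.inr ⟨hθ, ht1.acuteSplit hLP ht2, hweak, ?_⟩, hLP, hsupp⟩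
    by_contra! hcon
    refine hk (mem_overlaps_iff.2 ⟨L, hLP, fun p hp q hq hqL => ?_, hsupp⟩)
    have h1 := hweak p hp q hq hqL
    have h2 := hcon p hp q hq hqL
    exact ⟨lt_of_le_of_ne h1.1 h2.1, lt_of_le_of_ne h1.2 h2.2.symm⟩

theorem encard_changes_le {P : Finset Pt} (hP : GeneralPosition P) :
    (changes P).encard ≤ (1280 * P.card : ℕ) := by
  have hT : (tieEvents P ∪ contactEvents P).encard ≤ (80 * P.card : ℕ) := by
    refine (Set.encard_union_le _ _).trans
      ((add_le_add (encard_tieEvents_le hP) (encard_contactEvents_le P)).trans ?_)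
    norm_cast
    omega
  have h := encard_le_of_rel (S := changes P)
    (fun ev x => ev.1 = x.1 ∧ ev.2.pair = x.2.1 ∧ x.2.2 ⊆ P ∧
      Supports P x.2.2 (orient x.2.1 x.1) ev.2) (k := 16) hT ?_ ?_
  · rwa [← mul_assoc] at h
  · rintro ⟨θ, k⟩ hk
    obtain ⟨L, h1, h2, h3⟩ := exists_event_of_change hk
    exact ⟨_, h1, rfl, rfl, h2, h3⟩
  · rintro ⟨θ, i, L⟩ -
    by_cases hLP : L ⊆ P
    · refine le_trans (Set.encard_le_encard (t := (fun k => (θ, k)) ''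
        {k : OverlapKey | k.pair = i ∧ Supports P L (orient i θ) k}) ?_)
        ((Set.encard_image_le _ _).trans (encard_supports_le hP hLP i _))
      rintro ⟨θ', k⟩ ⟨-, rfl, h2, -, h3⟩
      exact ⟨k, ⟨h2, h3⟩, rfl⟩
    · exact (Set.encard_le_encard (t := ∅) fun ev hev => hLP hev.2.2.2.1).trans (by simp)

theorem overlapEvents_subset (P : Finset Pt) : overlapEvents P ⊆ changes P := by
  rintro ev ⟨h, ⟨h1, h2⟩ | ⟨h1, h2⟩⟩
  · exact ⟨h, Or.inl ⟨h1, h2.filter_mono nhdsWithin_le_nhds⟩⟩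
  · exact ⟨h, Or.inr ⟨h1, h2.filter_mono nhdsWithin_le_nhds⟩⟩

theorem releaseEvents_subset (P : Finset Pt) : releaseEvents P ⊆ changes P := by
  rintro ev ⟨h, ⟨h1, h2⟩ | ⟨h1, h2⟩⟩
  · exact ⟨h, Or.inl ⟨h1, h2.filter_mono nhdsWithin_le_nhds⟩⟩
  · exact ⟨h, Or.inr ⟨h1, h2.filter_mono nhdsWithin_le_nhds⟩⟩

theorem finite_and_ncard_le {α : Type*} {S : Set α} {m : ℕ} (h : S.encard ≤ m) :
    S.Finite ∧ S.ncard ≤ m := by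
  have hfin := Set.finite_of_encard_le_coe h
  refine ⟨hfin, ?_⟩
  rw [← hfin.cast_ncard_eq] at h
  exact_mod_cast h

end RectHull

theorem mainTheorem2 :
    ∃ C : ℕ, ∀ P : Finset RectHull.Pt, RectHull.GeneralPosition P →
      (∀ e ∈ RectHull.hullEdges P, ∀ f ∈ RectHull.hullEdges P,
        (RectHull.linkIntersections P e f).Finite ∧
        (RectHull.linkIntersections P e f).ncard ≤ C * P.card) ∧
      (RectHull.overlapEvents P).Finite ∧ (RectHull.releaseEvents P).Finite ∧
      (RectHull.overlapEvents P).ncard + (RectHull.releaseEvents P).ncard ≤ C * P.card := by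
  refine ⟨2560, fun P hP => ⟨fun e he f hf => ?_, ?_⟩⟩
  · obtain ⟨h1, h2⟩ := RectHull.finite_and_ncard_le (RectHull.encard_linkIntersections_le he hf)
    exact ⟨h1, by omega⟩
  · have h := RectHull.encard_changes_le hP
    obtain ⟨h1, h2⟩ := RectHull.finite_and_ncard_le
      ((Set.encard_le_encard (RectHull.overlapEvents_subset P)).trans h)
    obtain ⟨h3, h4⟩ := RectHull.finite_and_ncard_le
      ((Set.encard_le_encard (RectHull.releaseEvents_subset P)).trans h)
    exact ⟨h1, h3, by omega⟩
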